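/- All graphs are finite and have no loops or parallel edges; $|G|$ denotes the number of vertices of $G$. A subdivision of a graph $H$ is a graph obtained from $H$ by replacing each edge $uv$ by a path of length at least one between $u$ and $v$, where these paths are pairwise internally disjoint and have no vertex of $H$ in their interiors; an edge may be left unsubdivided. A graph $G$ contains an induced subdivision of $H$ if some induced subgraph of $G$ is isomorphic to a subdivision of $H$. Disjoint sets $A,B\subseteq V(G)$ are anticomplete if no vertex in $A$ has a neighbour in $B$. Theorem. For every graph $H$ there exists $c>0$ such that every graph $G$ with at least two vertices and at most $c|G|^2$ edges satisfies at least one of the following: (i) $G$ contains an induced subdivision of $H$; (ii) $G$ contains disjoint, anticomplete sets $A,B$ with $|A|\ge c|G|$ and $|B|\ge c|G|$. -/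

import Mathlib

/-- `IsSubdivision H J`: the graph `J` is a subdivision of the graph `H`, that is, `J` arises from `H`
by replacing each edge `uv` of `H` by a path of length at least one between `u` and `v`. Here `f` gives
the branch vertices and `p h` is the path that replaces the edge `h : H.Adj u v` (the two orientations
of an edge give the same path, reversed). The paths have no branch vertices in their interior, two
different paths meet only in branch vertices, and `J` has no further vertices and no further edges. -/
def SimpleGraph.IsSubdivision {W : Type*} {U : Type*} (H : SimpleGraph W) (J : SimpleGraph U) : Prop :=
  ∃ (f : W ↪ U) (p : ∀ ⦃u v : W⦄, H.Adj u v → J.Walk (f u) (f v)),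
    (∀ ⦃u v : W⦄ (h : H.Adj u v), (p h).IsPath) ∧
    (∀ ⦃u v : W⦄ (h : H.Adj u v), p h.symm = (p h).reverse) ∧
    (∀ ⦃u v : W⦄ (h : H.Adj u v) (w : W), f w ∈ (p h).support → w = u ∨ w = v) ∧
    (∀ ⦃u v u' v' : W⦄ (h : H.Adj u v) (h' : H.Adj u' v'), s(u, v) ≠ s(u', v') →
      ∀ x : U, x ∈ (p h).support → x ∈ (p h').support → x ∈ Set.range f) ∧
    (∀ x : U, x ∈ Set.range f ∨ ∃ (u v : W) (h : H.Adj u v), x ∈ (p h).support) ∧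
    (∀ e ∈ J.edgeSet, ∃ (u v : W) (h : H.Adj u v), e ∈ (p h).edges)

/-- `G` contains an induced subdivision of `H`: some induced subgraph of `G` is a subdivision of `H`. -/
def SimpleGraph.ContainsInducedSubdivision {V : Type*} {W : Type*}
    (G : SimpleGraph V) (H : SimpleGraph W) : Prop :=
  ∃ s : Set V, H.IsSubdivision (G.induce s)

/-- Two vertex sets are anticomplete in `G` if they are disjoint and there is no edge of `G` between
them. -/
def SimpleGraph.Anticomplete {V : Type*} (G : SimpleGraph V) (A B : Finset V) : Prop :=
  Disjoint A B ∧ ∀ a ∈ A, ∀ b ∈ B, ¬ G.Adj a b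

/-! If (ii) fails at scale m, then any two m-element sets touch (`Coherent`). By sparsity at least
half of the vertices have degree at most m, where m is a small fraction of the order, so one may
work in the subgraph they induce. There it suffices to find a `Model`: pairwise non-touching hubs,
and for each edge of H a connected set attached to its two ends and to no other hub, with different
connectors not touching. Shortest paths through the connectors have no chords, and their union is an
induced subdivision (`Model.containsInducedSubdivision`).

The engine is `exists_common_target`. Take many disjoint large blocks and an accessible family of
sets, that is, one whose nonempty members stay in the family on deleting a suitable vertex. A
minimal member inside one block that reaches half of some other block reaches barely more than half
of any block. Restrict the block it half covers to its neighbours, restrict the others to its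
non-neighbours, and repeat. This leaves many pairwise non-touching members that all cover one large
set A.

There are two cases, according to trees of height at most 21.

If every large set includes such a tree with m vertices, apply the engine to trees, with one tree
per edge of H. Hubs are taken in A, and each edge of H is routed through the root of its tree. The
routes have bounded size, so degrees bounded by m allow hubs that avoid the routes of other hubs
(`exists_model_of_rooted`).

Otherwise some large induced subgraph has only small balls of radius 21. Coherence then gives
connected cores, pairwise far apart, each at distance exactly 3 from almost every vertex
(`exists_cores`). Replace each vertex z by the union Y z of its short paths to the cores and apply
the engine to the graph of touching sets. A vertex v of A receives many non-touching legs, and by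
pigeonhole many of them attach at one point y of Y v, which becomes a hub. Legs of distinct hubs are
paired up through cores (`exists_model_of_not_rooted`). -/

namespace InducedSubdivision

/-! ### Non-touching sets covering a common large set -/

section
open scoped Classical

variable {V : Type*}

/-- Two vertex sets touch if they intersect or are joined by an edge. -/
def Touch (G : SimpleGraph V) (S T : Finset V) : Prop :=
  ∃ x ∈ S, ∃ y ∈ T, x = y ∨ G.Adj x y

theorem Touch.symm {G : SimpleGraph V} {S T : Finset V} (h : Touch G S T) : Touch G T S := by
  obtain ⟨x, hx, y, hy, h⟩ := h
  exact ⟨y, hy, x, hx, h.imp Eq.symm fun h => h.symm⟩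

theorem Touch.mono {G : SimpleGraph V} {S T S' T' : Finset V} (h : Touch G S T)
    (hS : S ⊆ S') (hT : T ⊆ T') : Touch G S' T' := by
  obtain ⟨x, hx, y, hy, h⟩ := h
  exact ⟨x, hS hx, y, hT hy, h⟩

/-- Any two subsets of `W` with at least `m` elements touch. -/
def Coherent (G : SimpleGraph V) (W : Finset V) (m : ℕ) : Prop :=
  ∀ A ⊆ W, ∀ B ⊆ W, m ≤ A.card → m ≤ B.card → Touch G A B

/-- The vertices of `B` with a neighbour in `T`. -/
noncomputable def hit (G : SimpleGraph V) (T B : Finset V) : Finset V :=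
  B.filter fun v => ∃ u ∈ T, G.Adj u v

/-- A configuration of disjoint blocks `B i`, each covered by the members of a family `C i`. All
covering sets are pairwise non-touching and do not touch the blocks of the other families. -/
structure Stage (G : SimpleGraph V) (W : Finset V) (M : ℕ) (F : Finset V → Prop)
    (I : Finset ℕ) (B : ℕ → Finset V) (C : ℕ → Finset (Finset V)) : Prop where
  sub : ∀ i ∈ I, B i ⊆ W
  big : ∀ i ∈ I, 3 ^ I.card * M ≤ (B i).card
  disj : ∀ i ∈ I, ∀ j ∈ I, i ≠ j → Disjoint (B i) (B j)
  fam : ∀ i ∈ I, ∀ T ∈ C i, F T ∧ T ⊆ W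
  cover : ∀ i ∈ I, ∀ T ∈ C i, ∀ v ∈ B i, ∃ u ∈ T, G.Adj u v
  own : ∀ i ∈ I, ∀ T ∈ C i, Disjoint T (B i)
  other : ∀ i ∈ I, ∀ T ∈ C i, ∀ k ∈ I, k ≠ i → ¬ Touch G T (B k)
  sep : ∀ i ∈ I, ∀ T ∈ C i, ∀ j ∈ I, ∀ T' ∈ C j, T ≠ T' → ¬ Touch G T T'

/-- By coherence a member with m elements misses fewer than m vertices of each block, so some member
reaches half of a block. Take a smallest one: erasing a suitable vertex drops it below half on every
block, and that vertex accounts for at most m neighbours. -/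
theorem exists_minimal_hitting {G : SimpleGraph V} {W : Finset V} {m M : ℕ}
    (hcoh : Coherent G W m) (hdeg : ∀ x ∈ W, (W.filter (G.Adj x)).card ≤ m)
    (hM : 2 * m ≤ M) (hMpos : 0 < M) {F : Finset V → Prop}
    (hacc : ∀ T, F T → T.Nonempty → ∃ x ∈ T, F (T.erase x))
    (hF : ∀ X ⊆ W, 3 * M ≤ X.card → ∃ T ⊆ X, F T ∧ m ≤ T.card)
    {J : Finset ℕ} (hJ : J.Nonempty) {X : Finset V} {B : ℕ → Finset V}
    (hX : X ⊆ W) (hXM : 3 * M ≤ X.card)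
    (hB : ∀ k ∈ J, B k ⊆ W) (hBM : ∀ k ∈ J, 3 * M ≤ (B k).card)
    (hdisj : ∀ k ∈ J, Disjoint X (B k)) :
    ∃ T ⊆ X, F T ∧ T.Nonempty ∧ (∃ l ∈ J, (B l).card ≤ 2 * (hit G T (B l)).card) ∧
      ∀ k ∈ J, 2 * (hit G T (B k)).card ≤ (B k).card + 2 * m := by
  let P : Finset V → Prop := fun T =>
    T ⊆ X ∧ F T ∧ ∃ l ∈ J, (B l).card ≤ 2 * (hit G T (B l)).card
  have hex : ∃ T, P T := by
    obtain ⟨T, hTX, hFT, hTm⟩ := hF X hX hXM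
    obtain ⟨k, hk⟩ := hJ
    refine ⟨T, hTX, hFT, k, hk, ?_⟩
    by_contra hlt
    have hsub : hit G T (B k) ⊆ B k := Finset.filter_subset _ _
    have hc := Finset.card_sdiff_add_card_eq_card hsub
    have := hBM k hk
    obtain ⟨x, hx, y, hy, h⟩ := hcoh T (hTX.trans hX) (B k \ hit G T (B k))
      (Finset.sdiff_subset.trans (hB k hk)) hTm (by omega)
    rw [Finset.mem_sdiff] at hy
    rcases h with rfl | h
    · exact Finset.disjoint_left.1 (hdisj k hk) (hTX hx) hy.1
    · exact hy.2 (Finset.mem_filter.2 ⟨hy.1, x, hx, h⟩)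
  obtain ⟨T, hT, hmin⟩ : ∃ T, P T ∧ ∀ T', P T' → T.card ≤ T'.card := by
    have hex' : ∃ n, ∃ T, P T ∧ T.card = n := by
      obtain ⟨T, hT⟩ := hex
      exact ⟨_, T, hT, rfl⟩
    obtain ⟨T, hT, hn⟩ := Nat.find_spec hex'
    exact ⟨T, hT, fun T' hT' => hn ▸ Nat.find_min' hex' ⟨T', hT', rfl⟩⟩
  obtain ⟨hTX, hFT, l, hl, hlh⟩ := hT
  have hne : T.Nonempty := by
    by_contra h
    rw [Finset.not_nonempty_iff_eq_empty] at h
    have : hit G T (B l) = ∅ := by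
      subst h
      simp [hit]
    rw [this] at hlh
    have := hBM l hl
    simp at hlh
    rw [hlh] at this
    simp at this
    omega
  refine ⟨T, hTX, hFT, hne, ⟨l, hl, hlh⟩, fun k hk => ?_⟩
  obtain ⟨x, hx, hFx⟩ := hacc T hFT hne
  have h1 : 2 * (hit G (T.erase x) (B k)).card < (B k).card := by
    by_contra h
    have := hmin (T.erase x) ⟨(Finset.erase_subset _ _).trans hTX, hFx, k, hk, by omega⟩
    rw [Finset.card_erase_of_mem hx] at this
    have := Finset.card_pos.2 hne
    omega
  have h2 : hit G T (B k) ⊆ hit G (T.erase x) (B k) ∪ W.filter (G.Adj x) := by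
    intro v hv
    obtain ⟨hvB, u, hu, huv⟩ := Finset.mem_filter.1 hv
    by_cases hux : u = x
    · exact Finset.mem_union_right _ (Finset.mem_filter.2 ⟨hB k hk hvB, hux ▸ huv⟩)
    · exact Finset.mem_union_left _
        (Finset.mem_filter.2 ⟨hvB, u, Finset.mem_erase.2 ⟨hux, hu⟩, huv⟩)
  have h3 := (Finset.card_le_card h2).trans (Finset.card_union_le _ _)
  have h4 := hdeg x (hX (hTX hx))
  omega

/-- Block i is spent to produce T, which joins the family of the block it half covers; the family of
i is discarded. Each surviving block keeps at least half its size minus m. Since 2m ≤ M, this is at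
least a third, which explains the powers of 3. -/
theorem Stage.step {G : SimpleGraph V} {W : Finset V} {m M : ℕ}
    (hcoh : Coherent G W m) (hdeg : ∀ x ∈ W, (W.filter (G.Adj x)).card ≤ m)
    (hM : 2 * m ≤ M) (hMpos : 0 < M) {F : Finset V → Prop}
    (hacc : ∀ T, F T → T.Nonempty → ∃ x ∈ T, F (T.erase x))
    (hF : ∀ X ⊆ W, 3 * M ≤ X.card → ∃ T ⊆ X, F T ∧ m ≤ T.card)
    {I : Finset ℕ} {B : ℕ → Finset V} {C : ℕ → Finset (Finset V)} (hs : Stage G W M F I B C)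
    {i : ℕ} (hi : i ∈ I) (hI : 1 < I.card) :
    ∃ l ∈ I.erase i, ∃ (B' : ℕ → Finset V) (T : Finset V), T ∉ C l ∧
      Stage G W M F (I.erase i) B' (Function.update C l (insert T (C l))) := by
  have hIe : (I.erase i).card + 1 = I.card := Finset.card_erase_add_one hi
  have hpow : 3 ^ I.card * M = 3 * (3 ^ (I.erase i).card * M) := by
    rw [← hIe, pow_succ]; ring
  have hone : 1 ≤ 3 ^ (I.erase i).card := Nat.one_le_pow _ _ (by norm_num)
  have hM1 : M ≤ 3 ^ (I.erase i).card * M := Nat.le_mul_of_pos_left _ hone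
  have hbig : ∀ k ∈ I, 3 * M ≤ (B k).card := fun k hk => by
    have := hs.big k hk
    omega
  have hJ : (I.erase i).Nonempty := Finset.card_pos.1 (by omega)
  have hJI : ∀ k ∈ I.erase i, k ∈ I := fun k hk => Finset.mem_of_mem_erase hk
  have hJi : ∀ k ∈ I.erase i, k ≠ i := fun k hk => Finset.ne_of_mem_erase hk
  obtain ⟨T, hTB, hFT, hTne, ⟨l, hl, hlh⟩, hsmall⟩ := exists_minimal_hitting hcoh hdeg hM hMpos
    hacc hF hJ (hs.sub i hi) (hbig i hi) (fun k hk => hs.sub k (hJI k hk))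
    (fun k hk => hbig k (hJI k hk)) (fun k hk => hs.disj i hi k (hJI k hk) (hJi k hk).symm)
  let B' : ℕ → Finset V := fun k => if k = l then hit G T (B l) else B k \ hit G T (B k)
  have hB'l : B' l = hit G T (B l) := if_pos rfl
  have hB'n : ∀ k, k ≠ l → B' k = B k \ hit G T (B k) := fun k hk => if_neg hk
  have hB'sub : ∀ k, B' k ⊆ B k := by
    intro k
    by_cases h : k = l
    · subst h
      rw [hB'l]
      exact Finset.filter_subset _ _
    · rw [hB'n k h]
      exact Finset.sdiff_subset
  have hTdisj : ∀ k ∈ I.erase i, Disjoint T (B k) := fun k hk =>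
    Finset.disjoint_of_subset_left hTB (hs.disj i hi k (hJI k hk) (hJi k hk).symm)
  have hTold : ∀ k ∈ I.erase i, ∀ S ∈ C k, ¬ Touch G S T := fun k hk S hS h =>
    hs.other k (hJI k hk) S hS i hi (hJi k hk).symm (h.mono subset_rfl hTB)
  have hTother : ∀ k ∈ I.erase i, k ≠ l → ¬ Touch G T (B' k) := by
    rintro k hk hkl ⟨x, hx, y, hy, h⟩
    rw [hB'n k hkl, Finset.mem_sdiff] at hy
    rcases h with rfl | h
    · exact Finset.disjoint_left.1 (hTdisj k hk) hx hy.1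
    · exact hy.2 (Finset.mem_filter.2 ⟨hy.1, x, hx, h⟩)
  have hmem : ∀ k, ∀ S ∈ Function.update C l (insert T (C l)) k, (k = l ∧ S = T) ∨ S ∈ C k := by
    intro k S hS
    by_cases h : k = l
    · subst h
      rw [Function.update_self, Finset.mem_insert] at hS
      exact hS.imp (fun h => ⟨rfl, h⟩) id
    · rw [Function.update_of_ne h] at hS
      exact Or.inr hS
  refine ⟨l, hl, B', T, ?_, ?_⟩
  · intro hT
    obtain ⟨x, hx⟩ := hTne
    exact hTold l hl T hT ⟨x, hx, x, hx, Or.inl rfl⟩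
  · refine ⟨?_, ?_, ?_, ?_, ?_, ?_, ?_, ?_⟩
    · exact fun k hk => (hB'sub k).trans (hs.sub k (hJI k hk))
    · intro k hk
      have h1 := hs.big k (hJI k hk)
      have h2 := hsmall k hk
      by_cases h : k = l
      · subst h
        rw [hB'l]
        omega
      · rw [hB'n k h]
        have hsub : hit G T (B k) ⊆ B k := Finset.filter_subset _ _
        have hc := Finset.card_sdiff_add_card_eq_card hsub
        omega
    · exact fun j hj k hk hjk => Finset.disjoint_of_subset_left (hB'sub j)
        (Finset.disjoint_of_subset_right (hB'sub k) (hs.disj j (hJI j hj) k (hJI k hk) hjk))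
    · intro k hk S hS
      rcases hmem k S hS with ⟨-, rfl⟩ | hS
      · exact ⟨hFT, hTB.trans (hs.sub i hi)⟩
      · exact hs.fam k (hJI k hk) S hS
    · intro k hk S hS v hv
      rcases hmem k S hS with ⟨rfl, rfl⟩ | hS
      · rw [hB'l] at hv
        exact (Finset.mem_filter.1 hv).2
      · exact hs.cover k (hJI k hk) S hS v (hB'sub k hv)
    · intro k hk S hS
      rcases hmem k S hS with ⟨-, rfl⟩ | hS
      · exact Finset.disjoint_of_subset_right (hB'sub k) (hTdisj k hk)
      · exact Finset.disjoint_of_subset_right (hB'sub k) (hs.own k (hJI k hk) S hS)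
    · intro k hk S hS j hj hjk
      rcases hmem k S hS with ⟨rfl, rfl⟩ | hS
      · exact hTother j hj hjk
      · exact fun h => hs.other k (hJI k hk) S hS j (hJI j hj) hjk (h.mono subset_rfl (hB'sub j))
    · intro k hk S hS j hj S' hS' hne
      rcases hmem k S hS with ⟨-, h1⟩ | h1 <;> rcases hmem j S' hS' with ⟨-, h2⟩ | h2
      · exact absurd (h1.trans h2.symm) hne
      · exact fun h => hTold j hj S' h2 (h1 ▸ h.symm)
      · exact h2 ▸ hTold k hk S h1
      · exact hs.sep k (hJI k hk) S h1 j (hJI j hj) S' h2 hne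

/-- The potential `∑ 2 ^ (C i).card` never decreases if the block spent has the smallest family: its
term is lost, but the term of the block that gains a set doubles, and was at least as large. The
last block alone then carries the whole potential. -/
theorem Stage.exists_common_target {G : SimpleGraph V} {W : Finset V} {m M : ℕ}
    (hcoh : Coherent G W m) (hdeg : ∀ x ∈ W, (W.filter (G.Adj x)).card ≤ m)
    (hM : 2 * m ≤ M) (hMpos : 0 < M) {F : Finset V → Prop}
    (hacc : ∀ T, F T → T.Nonempty → ∃ x ∈ T, F (T.erase x))
    (hF : ∀ X ⊆ W, 3 * M ≤ X.card → ∃ T ⊆ X, F T ∧ m ≤ T.card) (K : ℕ) :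
    ∀ (n : ℕ) (I : Finset ℕ) (B : ℕ → Finset V) (C : ℕ → Finset (Finset V)), I.card = n + 1 →
      Stage G W M F I B C → 2 ^ K ≤ ∑ i ∈ I, 2 ^ (C i).card →
      ∃ A ⊆ W, ∃ D : Finset (Finset V), 3 * M ≤ A.card ∧ K ≤ D.card ∧
        (∀ T ∈ D, F T ∧ T ⊆ W ∧ Disjoint T A ∧ ∀ v ∈ A, ∃ u ∈ T, G.Adj u v) ∧
        ∀ T ∈ D, ∀ T' ∈ D, T ≠ T' → ¬ Touch G T T' := by
  intro n
  induction n with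
  | zero =>
    intro I B C hI hs hsum
    obtain ⟨i, rfl⟩ := Finset.card_eq_one.1 hI
    have hi : i ∈ ({i} : Finset ℕ) := Finset.mem_singleton_self i
    refine ⟨B i, hs.sub i hi, C i, ?_, ?_, ?_, ?_⟩
    · simpa using hs.big i hi
    · rw [Finset.sum_singleton] at hsum
      exact (Nat.pow_le_pow_iff_right (by norm_num)).1 hsum
    · exact fun T hT => ⟨(hs.fam i hi T hT).1, (hs.fam i hi T hT).2, hs.own i hi T hT,
        hs.cover i hi T hT⟩
    · exact fun T hT T' hT' => hs.sep i hi T hT i hi T' hT'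
  | succ n ih =>
    intro I B C hI hs hsum
    obtain ⟨i, hi, hmin⟩ := Finset.exists_min_image I (fun i => (C i).card)
      (Finset.card_pos.1 (by omega))
    obtain ⟨l, hl, B', T, hT, hs'⟩ := hs.step hcoh hdeg hM hMpos hacc hF hi (by omega)
    refine ih (I.erase i) B' _ (by rw [Finset.card_erase_of_mem hi]; omega) hs' (hsum.trans ?_)
    rw [← Finset.add_sum_erase I _ hi, ← Finset.add_sum_erase (I.erase i) _ hl,
      ← Finset.add_sum_erase (I.erase i) _ hl, Function.update_self,
      Finset.card_insert_of_notMem hT, pow_succ]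
    have h1 : 2 ^ (C i).card ≤ 2 ^ (C l).card :=
      Nat.pow_le_pow_right (by norm_num) (hmin l (Finset.mem_of_mem_erase hl))
    have h2 : ∑ x ∈ (I.erase i).erase l, 2 ^ (C x).card =
        ∑ x ∈ (I.erase i).erase l, 2 ^ (Function.update C l (insert T (C l)) x).card :=
      Finset.sum_congr rfl fun x hx => by rw [Function.update_of_ne (Finset.ne_of_mem_erase hx)]
    omega

theorem exists_disjoint_blocks (s : ℕ) : ∀ (N : ℕ) (W : Finset V), N * s ≤ W.card →
    ∃ B : ℕ → Finset V, (∀ i < N, B i ⊆ W ∧ (B i).card = s) ∧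
      ∀ i < N, ∀ j < N, i ≠ j → Disjoint (B i) (B j) := by
  intro N
  induction N with
  | zero => exact fun W _ => ⟨fun _ => ∅, by simp, by simp⟩
  | succ N ih =>
    intro W hW
    rw [Nat.succ_mul] at hW
    obtain ⟨S, hSW, hS⟩ := Finset.exists_subset_card_eq (show s ≤ W.card by omega)
    obtain ⟨B, hB, hd⟩ := ih (W \ S) (by
      have := Finset.card_sdiff_add_card_eq_card hSW
      omega)
    have hBS : ∀ i < N, Disjoint (B i) S := fun i hi =>
      Finset.disjoint_of_subset_left (hB i hi).1 Finset.sdiff_disjoint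
    refine ⟨fun i => if i = N then S else B i, ?_, ?_⟩
    · intro i hi
      by_cases h : i = N
      · simp [h, hSW, hS]
      · simp only [if_neg h]
        have := hB i (by omega)
        exact ⟨this.1.trans Finset.sdiff_subset, this.2⟩
    · intro i hi j hj hij
      by_cases h : i = N <;> by_cases h' : j = N
      · omega
      · simp only [if_pos h, if_neg h']
        exact (hBS j (by omega)).symm
      · simp only [if_neg h, if_pos h']
        exact hBS i (by omega)
      · simp only [if_neg h, if_neg h']
        exact hd i (by omega) j (by omega) hij

/-- In a sparse coherent graph, `K` pairwise non-touching sets from an accessible family that has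
large members inside all large sets cover a common large set. -/
theorem exists_common_target {G : SimpleGraph V} {W : Finset V} {m M : ℕ}
    (hcoh : Coherent G W m) (hdeg : ∀ x ∈ W, (W.filter (G.Adj x)).card ≤ m)
    (hM : 2 * m ≤ M) (hMpos : 0 < M) {F : Finset V → Prop}
    (hacc : ∀ T, F T → T.Nonempty → ∃ x ∈ T, F (T.erase x))
    (hF : ∀ X ⊆ W, 3 * M ≤ X.card → ∃ T ⊆ X, F T ∧ m ≤ T.card) (K : ℕ)
    (hW : 2 ^ K * (3 ^ 2 ^ K * M) ≤ W.card) :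
    ∃ A ⊆ W, ∃ D : Finset (Finset V), 3 * M ≤ A.card ∧ K ≤ D.card ∧
      (∀ T ∈ D, F T ∧ T ⊆ W ∧ Disjoint T A ∧ ∀ v ∈ A, ∃ u ∈ T, G.Adj u v) ∧
      ∀ T ∈ D, ∀ T' ∈ D, T ≠ T' → ¬ Touch G T T' := by
  obtain ⟨B, hB, hd⟩ := exists_disjoint_blocks (3 ^ 2 ^ K * M) (2 ^ K) W hW
  have hpos : 0 < 2 ^ K := by positivity
  -- With empty families each of the `2 ^ K` blocks contributes 1 to the potential.
  refine Stage.exists_common_target hcoh hdeg hM hMpos hacc hF K (2 ^ K - 1)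
    (Finset.range (2 ^ K)) B (fun _ => ∅) (by rw [Finset.card_range]; omega) ?_ (by simp)
  refine ⟨fun i hi => (hB i (Finset.mem_range.1 hi)).1, fun i hi => ?_,
    fun i hi j hj => hd i (Finset.mem_range.1 hi) j (Finset.mem_range.1 hj), ?_, ?_, ?_, ?_, ?_⟩
  · rw [Finset.card_range, (hB i (Finset.mem_range.1 hi)).2]
  all_goals simp

end

/-! ### Connected sets, rooted sets, models and independent choices -/

section
open scoped Classical

variable {V : Type*} {G : SimpleGraph V}

/-- Any two vertices of `S` are joined by a walk inside `S`. -/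
def Conn (G : SimpleGraph V) (S : Finset V) : Prop :=
  ∀ x ∈ S, ∀ y ∈ S, ∃ p : G.Walk x y, ∀ z ∈ p.support, z ∈ S

theorem Conn.of_center {S : Finset V} {c : V}
    (h : ∀ x ∈ S, ∃ p : G.Walk x c, ∀ z ∈ p.support, z ∈ S) : Conn G S := by
  intro x hx y hy
  obtain ⟨p, hp⟩ := h x hx
  obtain ⟨q, hq⟩ := h y hy
  refine ⟨p.append q.reverse, fun z hz => ?_⟩
  rw [SimpleGraph.Walk.mem_support_append_iff, SimpleGraph.Walk.support_reverse,
    List.mem_reverse] at hz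
  exact hz.elim (hp z) (hq z)

theorem Conn.singleton (v : V) : Conn G {v} := by
  refine Conn.of_center (c := v) fun x hx => ?_
  rw [Finset.mem_singleton] at hx
  subst hx
  exact ⟨SimpleGraph.Walk.nil, by simp⟩

theorem Conn.insert {S : Finset V} {u v : V} (hS : Conn G S) (hu : u ∈ S) (h : G.Adj u v) :
    Conn G (Insert.insert v S) := by
  refine Conn.of_center (c := u) fun x hx => ?_
  rcases Finset.mem_insert.1 hx with rfl | hx
  · refine ⟨SimpleGraph.Walk.cons h.symm SimpleGraph.Walk.nil, fun z hz => ?_⟩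
    simp only [SimpleGraph.Walk.support_cons, SimpleGraph.Walk.support_nil, List.mem_cons,
      List.not_mem_nil, or_false] at hz
    rcases hz with rfl | rfl
    · exact Finset.mem_insert_self _ _
    · exact Finset.mem_insert_of_mem hu
  · obtain ⟨p, hp⟩ := hS x hx u hu
    exact ⟨p, fun z hz => Finset.mem_insert_of_mem (hp z hz)⟩

theorem Conn.union_biUnion {ι : Type*} {S : Finset V} (hS : Conn G S) {c : V} (hc : c ∈ S)
    {I : Finset ι} {L : ι → Finset V} (hL : ∀ i ∈ I, Conn G (L i) ∧ ∃ x ∈ L i, x ∈ S) :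
    Conn G (S ∪ I.biUnion L) := by
  refine Conn.of_center (c := c) fun x hx => ?_
  rcases Finset.mem_union.1 hx with hx | hx
  · obtain ⟨p, hp⟩ := hS x hx c hc
    exact ⟨p, fun z hz => Finset.mem_union_left _ (hp z hz)⟩
  · obtain ⟨i, hi, hx⟩ := Finset.mem_biUnion.1 hx
    obtain ⟨hLi, y, hyL, hyS⟩ := hL i hi
    obtain ⟨p, hp⟩ := hLi x hx y hyL
    obtain ⟨q, hq⟩ := hS y hyS c hc
    refine ⟨p.append q, fun z hz => ?_⟩
    rw [SimpleGraph.Walk.mem_support_append_iff] at hz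
    rcases hz with hz | hz
    · exact Finset.mem_union_right _ (Finset.mem_biUnion.2 ⟨i, hi, hp z hz⟩)
    · exact Finset.mem_union_left _ (hq z hz)

theorem Conn.union {S T : Finset V} (hS : Conn G S) (hT : Conn G T) {c : V} (hcS : c ∈ S)
    (hcT : c ∈ T) : Conn G (S ∪ T) := by
  have := hS.union_biUnion hcS (I := {()}) (L := fun _ => T) fun _ _ => ⟨hT, c, hcT, hcS⟩
  simpa using this

/-- `T` is spanned by a tree with root `x` and height at most `r`, given by a level function. -/
def Rooted (G : SimpleGraph V) (r : ℕ) (x : V) (T : Finset V) : Prop :=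
  ∃ l : V → ℕ, ∀ v ∈ T, l v ≤ r ∧ (v = x ∨ ∃ u ∈ T, G.Adj u v ∧ l u < l v)

/-- A vertex of maximum level is the parent of no other. This makes rooted sets of bounded height an
accessible family. -/
theorem Rooted.exists_erase {r : ℕ} {x : V} {T : Finset V} (h : Rooted G r x T)
    (hT : T.Nonempty) : ∃ v ∈ T, Rooted G r x (T.erase v) := by
  obtain ⟨l, hl⟩ := h
  obtain ⟨v, hv, hmax⟩ := Finset.exists_max_image T l hT
  refine ⟨v, hv, l, fun w hw => ?_⟩
  have hwT := Finset.mem_of_mem_erase hw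
  refine ⟨(hl w hwT).1, (hl w hwT).2.imp id ?_⟩
  rintro ⟨u, hu, huw, hlt⟩
  refine ⟨u, Finset.mem_erase.2 ⟨?_, hu⟩, huw, hlt⟩
  rintro rfl
  exact absurd (hmax w hwT) (by omega)

theorem Rooted.exists_path {r : ℕ} {x : V} {T : Finset V} (h : Rooted G r x T) {v : V}
    (hv : v ∈ T) : ∃ S ⊆ T, v ∈ S ∧ x ∈ S ∧ S.card ≤ r + 1 ∧ Conn G S := by
  obtain ⟨l, hl⟩ := h
  have key : ∀ n, ∀ v ∈ T, l v ≤ n → ∃ S ⊆ T, v ∈ S ∧ x ∈ S ∧ S.card ≤ n + 1 ∧ Conn G S := by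
    intro n
    induction n with
    | zero =>
      intro v hv hn
      rcases (hl v hv).2 with rfl | ⟨u, -, -, hlt⟩
      · exact ⟨{v}, by simpa using hv, by simp, by simp, by simp, Conn.singleton v⟩
      · omega
    | succ n ih =>
      intro v hv hn
      rcases (hl v hv).2 with rfl | ⟨u, hu, huv, hlt⟩
      · exact ⟨{v}, by simpa using hv, by simp, by simp, by simp, Conn.singleton v⟩
      · obtain ⟨S, hST, huS, hxS, hcard, hS⟩ := ih u hu (by omega)
        refine ⟨Insert.insert v S, Finset.insert_subset hv hST, Finset.mem_insert_self _ _,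
          Finset.mem_insert_of_mem hxS, (Finset.card_insert_le _ _).trans (by omega),
          hS.insert huS huv⟩
  obtain ⟨S, h1, h2, h3, h4, h5⟩ := key (l v) v hv le_rfl
  exact ⟨S, h1, h2, h3, h4.trans (by have := (hl v hv).1; omega), h5⟩

theorem Rooted.conn {r : ℕ} {x : V} {T : Finset V} (h : Rooted G r x T) : Conn G T := by
  refine Conn.of_center (c := x) fun v hv => ?_
  obtain ⟨S, hST, hvS, hxS, -, hS⟩ := h.exists_path hv
  obtain ⟨p, hp⟩ := hS v hvS x hxS
  exact ⟨p, fun z hz => hST (hp z hz)⟩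

theorem Rooted.mono {r s : ℕ} {x : V} {T : Finset V} (h : Rooted G r x T) (hrs : r ≤ s) :
    Rooted G s x T := by
  obtain ⟨l, hl⟩ := h
  exact ⟨l, fun v hv => ⟨(hl v hv).1.trans hrs, (hl v hv).2⟩⟩

theorem Rooted.map {V' : Type*} {G' : SimpleGraph V'} (f : G' ↪g G) {r : ℕ} {x : V'}
    {T : Finset V'} (h : Rooted G' r x T) : Rooted G r (f x) (T.map f.toEmbedding) := by
  obtain ⟨l, hl⟩ := h
  refine ⟨fun v => if hv : ∃ w, f w = v then l hv.choose else 0, fun v hv => ?_⟩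
  have hval : ∀ w, (if hv : ∃ w', f w' = f w then l hv.choose else 0) = l w := by
    intro w
    have hex : ∃ w', f w' = f w := ⟨w, rfl⟩
    rw [dif_pos hex, f.injective hex.choose_spec]
  obtain ⟨w, hw, rfl⟩ := Finset.mem_map.1 hv
  obtain ⟨h1, h2⟩ := hl w hw
  refine ⟨(hval w).le.trans h1, h2.imp (fun h => congrArg f h) ?_⟩
  rintro ⟨u, hu, huw, hlt⟩
  exact ⟨f u, Finset.mem_map_of_mem _ hu, f.map_adj_iff.2 huw,
    ((hval u).trans_lt hlt).trans_eq (hval w).symm⟩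

theorem Rooted.insert {r : ℕ} {x : V} {T : Finset V} (h : Rooted G r x T) {u v : V} (hu : u ∈ T)
    (hv : v ∉ T) (huv : G.Adj u v) : Rooted G (r + 1) x (Insert.insert v T) := by
  obtain ⟨l, hl⟩ := h
  have hne : ∀ w ∈ T, w ≠ v := fun w hw => by
    rintro rfl
    exact hv hw
  refine ⟨fun w => if w = v then r + 1 else l w, fun w hw => ?_⟩
  rcases Finset.mem_insert.1 hw with rfl | hw
  · refine ⟨by simp, Or.inr ⟨u, Finset.mem_insert_of_mem hu, huv, ?_⟩⟩
    have := (hl u hu).1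
    simp only [if_neg (hne u hu), if_true]
    omega
  · simp only [if_neg (hne w hw)]
    obtain ⟨h1, h2⟩ := hl w hw
    refine ⟨by omega, h2.imp id ?_⟩
    rintro ⟨y, hy, hyw, hlt⟩
    exact ⟨y, Finset.mem_insert_of_mem hy, hyw, by simpa only [if_neg (hne y hy)]⟩

/-- The set of hubs `h` and connectors `S` that contracts to a subdivision of `H`. -/
structure Model {W : Type*} (G : SimpleGraph V) (H : SimpleGraph W) (h : W → V)
    (S : Sym2 W → Finset V) : Prop where
  hub : ∀ a b, a ≠ b → ¬ Touch G {h a} {h b}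
  conn : ∀ e ∈ H.edgeSet, Conn G (S e)
  adj : ∀ e ∈ H.edgeSet, ∀ a ∈ e, ∃ u ∈ S e, G.Adj u (h a)
  notMem : ∀ e ∈ H.edgeSet, ∀ a, h a ∉ S e
  far : ∀ e ∈ H.edgeSet, ∀ a, a ∉ e → ¬ Touch G {h a} (S e)
  sep : ∀ e ∈ H.edgeSet, ∀ e' ∈ H.edgeSet, e ≠ e' → ¬ Touch G (S e) (S e')

theorem touch_map {V' : Type*} {G' : SimpleGraph V'} (f : G' ↪g G) {S T : Finset V'}
    (h : Touch G (S.map f.toEmbedding) (T.map f.toEmbedding)) : Touch G' S T := by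
  obtain ⟨x', hx', y', hy', h⟩ := h
  obtain ⟨x, hx, rfl⟩ := Finset.mem_map.1 hx'
  obtain ⟨y, hy, rfl⟩ := Finset.mem_map.1 hy'
  exact ⟨x, hx, y, hy, h.imp (fun h => f.injective h) fun h => f.map_adj_iff.1 h⟩

theorem Model.map {V' W : Type*} {G' : SimpleGraph V'} {H : SimpleGraph W} (f : G' ↪g G)
    {h : W → V'} {S : Sym2 W → Finset V'} (hm : Model G' H h S) :
    Model G H (f ∘ h) (fun e => (S e).map f.toEmbedding) := by
  have hs : ∀ a, ({(f ∘ h) a} : Finset V) = ({h a} : Finset V').map f.toEmbedding := fun a => by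
    rw [Finset.map_singleton]; rfl
  refine ⟨?_, ?_, ?_, ?_, ?_, ?_⟩
  · intro a b hab ht
    rw [hs, hs] at ht
    exact hm.hub a b hab (touch_map f ht)
  · intro e he x' hx' y' hy'
    obtain ⟨x, hx, rfl⟩ := Finset.mem_map.1 hx'
    obtain ⟨y, hy, rfl⟩ := Finset.mem_map.1 hy'
    obtain ⟨p, hp⟩ := hm.conn e he x hx y hy
    refine ⟨p.map f.toHom, fun z hz => ?_⟩
    rw [SimpleGraph.Walk.support_map] at hz
    obtain ⟨w, hw, rfl⟩ := List.mem_map.1 hz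
    exact Finset.mem_map_of_mem f.toEmbedding (hp w hw)
  · intro e he a ha
    obtain ⟨u, hu, hua⟩ := hm.adj e he a ha
    exact ⟨f u, Finset.mem_map_of_mem _ hu, f.map_adj_iff.2 hua⟩
  · intro e he a ha
    obtain ⟨x, hx, hxa⟩ := Finset.mem_map.1 ha
    rw [f.injective hxa] at hx
    exact hm.notMem e he a hx
  · intro e he a ha ht
    rw [hs] at ht
    exact hm.far e he a ha (touch_map f ht)
  · exact fun e he e' he' hne ht => hm.sep e he e' he' hne (touch_map f ht)

/-- A relation with small out-degree on a large set has an independent set. -/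
theorem exists_independent {W : Type*} [Fintype W] {R : V → V → Prop} {d : ℕ} {A : Finset V}
    (hR : ∀ v ∈ A, (A.filter (R v)).card ≤ d) (hA : Fintype.card W * (2 * d + 1) ≤ A.card) :
    ∃ f : W → V, (∀ a, f a ∈ A) ∧ ∀ a b, a ≠ b → f a ≠ f b ∧ ¬ R (f a) (f b) := by
  have key : ∀ (n : ℕ) (A : Finset V), (∀ v ∈ A, (A.filter (R v)).card ≤ d) →
      n * (2 * d + 1) ≤ A.card →
      ∃ B ⊆ A, B.card = n ∧ ∀ a ∈ B, ∀ b ∈ B, a ≠ b → ¬ R a b := by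
    intro n
    induction n with
    | zero => exact fun A _ _ => ⟨∅, by simp, by simp, by simp⟩
    | succ n ih =>
      intro A hR hA
      rw [Nat.succ_mul] at hA
      have hne : A.Nonempty := Finset.card_pos.1 (by omega)
      -- The average in-degree equals the average out-degree, so some v has both at most d; keeping
      -- v costs at most 2d + 1 vertices.
      obtain ⟨v, hv, hin⟩ : ∃ v ∈ A, (A.filter fun u => R u v).card ≤ d := by
        refine Finset.exists_le_of_sum_le hne ?_
        have := Finset.sum_card_bipartiteAbove_eq_sum_card_bipartiteBelow R (s := A) (t := A)
        simp only [Finset.bipartiteAbove, Finset.bipartiteBelow] at this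
        rw [← this]
        exact Finset.sum_le_sum hR
      let A' := A \ ({v} ∪ (A.filter (R v) ∪ A.filter fun u => R u v))
      have hA' : n * (2 * d + 1) ≤ A'.card := by
        have h1 := Finset.le_card_sdiff ({v} ∪ (A.filter (R v) ∪ A.filter fun u => R u v)) A
        have h2 := Finset.card_union_le {v} (A.filter (R v) ∪ A.filter fun u => R u v)
        have h3 := Finset.card_union_le (A.filter (R v)) (A.filter fun u => R u v)
        have h4 := hR v hv
        rw [Finset.card_singleton] at h2
        have : n * (2 * d + 1) + (1 + (d + d)) ≤ A.card := by omega
        change _ ≤ (A \ _).card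
        omega
      obtain ⟨B, hBA', hB, hind⟩ := ih A'
        (fun u hu => (Finset.card_le_card (Finset.filter_subset_filter _
          Finset.sdiff_subset)).trans (hR u (Finset.sdiff_subset hu))) hA'
      have hBv : ∀ b ∈ B, b ∈ A ∧ b ≠ v ∧ ¬ R v b ∧ ¬ R b v := by
        intro b hb
        have := hBA' hb
        simp only [A', Finset.mem_sdiff, Finset.mem_union, Finset.mem_singleton,
          Finset.mem_filter, not_or, not_and] at this
        exact ⟨this.1, this.2.1, this.2.2.1 this.1, this.2.2.2 this.1⟩
      refine ⟨Insert.insert v B, Finset.insert_subset hv (hBA'.trans Finset.sdiff_subset), ?_, ?_⟩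
      · rw [Finset.card_insert_of_notMem fun h => (hBv v h).2.1 rfl, hB]
      · intro a ha b hb hab
        rcases Finset.mem_insert.1 ha with h1 | h1 <;> rcases Finset.mem_insert.1 hb with h2 | h2
        · exact absurd (h1.trans h2.symm) hab
        · exact h1 ▸ (hBv b h2).2.2.1
        · exact h2 ▸ (hBv a h1).2.2.2
        · exact hind a h1 b h2 hab
  obtain ⟨B, hBA, hB, hind⟩ := key _ A hR hA
  have e : W ≃ B := Fintype.equivOfCardEq (by rw [Fintype.card_coe, hB])
  refine ⟨fun a => e a, fun a => hBA (e a).2, fun a b hab => ?_⟩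
  have : (e a : V) ≠ e b := fun h => hab (e.injective (Subtype.ext h))
  exact ⟨this, hind _ (e a).2 _ (e b).2 this⟩

end

/-! ### From a model to an induced subdivision -/

section
open scoped Classical

variable {V : Type*} {G : SimpleGraph V}

theorem mk_getVert_mem_edges {u v : V} (p : G.Walk u v) {i : ℕ} (hi : i < p.length) :
    s(p.getVert i, p.getVert (i + 1)) ∈ p.edges := by
  induction p generalizing i with
  | nil => simp at hi
  | cons h p ih =>
    cases i with
    | zero => simp
    | succ i =>
      rw [SimpleGraph.Walk.length_cons] at hi
      simpa using Or.inr (ih (show i < p.length by omega))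

theorem mk_mem_edges_induce {s : Set V} {u v : V} (p : G.Walk u v)
    (hp : ∀ z ∈ p.support, z ∈ s) (x y : s) (hxy : s((x : V), (y : V)) ∈ p.edges) :
    s(x, y) ∈ (p.induce s hp).edges := by
  induction p with
  | nil => simp at hxy
  | cons h p ih =>
    rw [SimpleGraph.Walk.edges_cons, List.mem_cons] at hxy
    rw [SimpleGraph.Walk.induce_cons, SimpleGraph.Walk.edges_cons, List.mem_cons]
    refine hxy.imp (fun h => ?_) fun h => ih _ h
    rcases Sym2.eq_iff.1 h with ⟨h1, h2⟩ | ⟨h1, h2⟩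
    · exact Sym2.eq_iff.2 (Or.inl ⟨Subtype.ext h1, Subtype.ext h2⟩)
    · exact Sym2.eq_iff.2 (Or.inr ⟨Subtype.ext h1, Subtype.ext h2⟩)

theorem induce_reverse {s : Set V} {u v : V} (p : G.Walk u v) (hp : ∀ z ∈ p.support, z ∈ s)
    (hp' : ∀ z ∈ p.reverse.support, z ∈ s) :
    p.reverse.induce s hp' = (p.induce s hp).reverse := by
  refine SimpleGraph.Walk.map_injective_of_injective
    (f := (SimpleGraph.Embedding.induce s).toHom)
    (SimpleGraph.Embedding.induce (G := G) s).injective _ _ ?_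
  rw [← SimpleGraph.Walk.reverse_map]
  exact (SimpleGraph.Walk.map_induce _ _).trans
    (congrArg SimpleGraph.Walk.reverse (SimpleGraph.Walk.map_induce _ _)).symm

/-- A shortest walk inside D works: a chord would shorten it. -/
theorem exists_chordless_path {D : Set V} {u v : V}
    (h : ∃ p : G.Walk u v, ∀ z ∈ p.support, z ∈ D) :
    ∃ p : G.Walk u v, p.IsPath ∧ (∀ z ∈ p.support, z ∈ D) ∧
      ∀ x ∈ p.support, ∀ y ∈ p.support, G.Adj x y → s(x, y) ∈ p.edges := by
  have hex : ∃ n, ∃ p : G.Walk u v, (∀ z ∈ p.support, z ∈ D) ∧ p.length = n := by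
    obtain ⟨p, hp⟩ := h
    exact ⟨_, p, hp, rfl⟩
  obtain ⟨p₀, hp₀, hn⟩ := Nat.find_spec hex
  have hmin₀ : ∀ q : G.Walk u v, (∀ z ∈ q.support, z ∈ D) → p₀.length ≤ q.length :=
    fun q hq => hn ▸ Nat.find_min' hex ⟨q, hq, rfl⟩
  obtain ⟨p, hpath, hp, hmin⟩ : ∃ p : G.Walk u v, p.IsPath ∧ (∀ z ∈ p.support, z ∈ D) ∧
      ∀ q : G.Walk u v, (∀ z ∈ q.support, z ∈ D) → p.length ≤ q.length :=
    ⟨p₀.bypass, p₀.bypass_isPath, fun z hz => hp₀ z (p₀.support_bypass_subset_support hz),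
      fun q hq => p₀.length_bypass_le_length.trans (hmin₀ q hq)⟩
  refine ⟨p, hpath, hp, ?_⟩
  have key : ∀ i j, i < j → j ≤ p.length → G.Adj (p.getVert i) (p.getVert j) →
      s(p.getVert i, p.getVert j) ∈ p.edges := by
    intro i j hij hj hadj
    have hlen := hmin ((p.take i).append (SimpleGraph.Walk.cons hadj (p.drop j))) (by
      intro z hz
      rw [SimpleGraph.Walk.mem_support_append_iff, SimpleGraph.Walk.support_cons,
        List.mem_cons] at hz
      rcases hz with hz | rfl | hz
      · obtain ⟨k, rfl, -⟩ := SimpleGraph.Walk.mem_support_iff_exists_getVert.1 hz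
        rw [SimpleGraph.Walk.take_getVert]
        exact hp _ (p.getVert_mem_support _)
      · exact hp _ (p.getVert_mem_support i)
      · obtain ⟨k, rfl, -⟩ := SimpleGraph.Walk.mem_support_iff_exists_getVert.1 hz
        rw [SimpleGraph.Walk.drop_getVert]
        exact hp _ (p.getVert_mem_support _))
    rw [SimpleGraph.Walk.length_append, SimpleGraph.Walk.length_cons,
      SimpleGraph.Walk.take_length, SimpleGraph.Walk.drop_length] at hlen
    obtain rfl : j = i + 1 := by
      have := min_le_left i p.length
      omega
    exact mk_getVert_mem_edges p (by omega)
  intro x hx y hy hxy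
  obtain ⟨i, rfl, hi⟩ := SimpleGraph.Walk.mem_support_iff_exists_getVert.1 hx
  obtain ⟨j, rfl, hj⟩ := SimpleGraph.Walk.mem_support_iff_exists_getVert.1 hy
  rcases lt_trichotomy i j with hij | rfl | hij
  · exact key i j hij hj hxy
  · exact absurd hxy (G.loopless.irrefl _)
  · rw [Sym2.eq_swap]
    exact key j i hij hi hxy.symm

theorem Model.injective {W : Type*} {H : SimpleGraph W} {h : W → V} {S : Sym2 W → Finset V}
    (hm : Model G H h S) : Function.Injective h := by
  intro a b hab
  by_contra hne
  exact hm.hub a b hne ⟨h a, by simp, h b, by simp, Or.inl hab⟩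

theorem Model.exists_paths {W : Type*} {H : SimpleGraph W} {h : W → V} {S : Sym2 W → Finset V}
    (hm : Model G H h S) : ∃ P : ∀ ⦃a b : W⦄, H.Adj a b → G.Walk (h a) (h b),
      (∀ ⦃a b⦄ (hab : H.Adj a b), P hab.symm = (P hab).reverse) ∧
      ∀ ⦃a b⦄ (hab : H.Adj a b), (P hab).IsPath ∧
        (∀ z ∈ (P hab).support, z ∈ S s(a, b) ∨ z = h a ∨ z = h b) ∧
        ∀ x ∈ (P hab).support, ∀ y ∈ (P hab).support, G.Adj x y → s(x, y) ∈ (P hab).edges := by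
  have hex : ∀ a b (hab : H.Adj a b), ∃ p : G.Walk (h a) (h b), p.IsPath ∧
      (∀ z ∈ p.support, z ∈ S s(a, b) ∨ z = h a ∨ z = h b) ∧
      ∀ x ∈ p.support, ∀ y ∈ p.support, G.Adj x y → s(x, y) ∈ p.edges := by
    intro a b hab
    refine exists_chordless_path (D := {z | z ∈ S s(a, b) ∨ z = h a ∨ z = h b}) ?_
    have he : s(a, b) ∈ H.edgeSet := hab
    obtain ⟨u, hu, hua⟩ := hm.adj _ he a (Sym2.mem_mk_left a b)
    obtain ⟨v, hv, hvb⟩ := hm.adj _ he b (Sym2.mem_mk_right a b)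
    obtain ⟨p, hp⟩ := hm.conn _ he u hu v hv
    refine ⟨SimpleGraph.Walk.cons hua.symm (p.concat hvb), fun z hz => ?_⟩
    rw [SimpleGraph.Walk.support_cons, SimpleGraph.Walk.support_concat, List.mem_cons,
      List.mem_append, List.mem_singleton] at hz
    rcases hz with rfl | hz | rfl
    · exact Or.inr (Or.inl rfl)
    · exact Or.inl (hp z hz)
    · exact Or.inr (Or.inr rfl)
  choose w hw using hex
  -- A well-order on W orients each edge, so that the paths chosen for its two orientations are
  -- reverses of each other.
  let P : ∀ ⦃a b : W⦄, H.Adj a b → G.Walk (h a) (h b) := fun a b hab =>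
    if WellOrderingRel a b then w a b hab else (w b a hab.symm).reverse
  have hP : ∀ ⦃a b⦄ (hab : H.Adj a b), WellOrderingRel a b → P hab = w a b hab :=
    fun a b hab hr => if_pos hr
  have hP' : ∀ ⦃a b⦄ (hab : H.Adj a b), ¬ WellOrderingRel a b →
      P hab = (w b a hab.symm).reverse := fun a b hab hr => if_neg hr
  refine ⟨P, fun a b hab => ?_, fun a b hab => ?_⟩
  · by_cases hr : WellOrderingRel a b
    · rw [hP hab hr, hP' hab.symm (asymm hr)]
    · have hr' : WellOrderingRel b a := by
        rcases trichotomous_of WellOrderingRel a b with h1 | h1 | h1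
        · exact absurd h1 hr
        · exact absurd h1 hab.ne
        · exact h1
      rw [hP' hab hr, hP hab.symm hr', SimpleGraph.Walk.reverse_reverse]
  · by_cases hr : WellOrderingRel a b
    · rw [hP hab hr]
      exact hw a b hab
    · rw [hP' hab hr]
      obtain ⟨h1, h2, h3⟩ := hw b a hab.symm
      refine ⟨h1.reverse, fun z hz => ?_, fun x hx y hy hxy => ?_⟩
      · rw [SimpleGraph.Walk.support_reverse, List.mem_reverse] at hz
        rw [Sym2.eq_swap]
        exact (h2 z hz).imp id Or.symm
      · rw [SimpleGraph.Walk.support_reverse, List.mem_reverse] at hx hy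
        rw [SimpleGraph.Walk.edges_reverse, List.mem_reverse]
        exact h3 x hx y hy hxy

/-- No unwanted edge appears: interiors of different paths lie in connectors that do not touch, a
hub is adjacent to a vertex of a path only if it is an end of that path, and within one path there
are no chords. -/
theorem Model.containsInducedSubdivision {W : Type*} {H : SimpleGraph W} {h : W → V}
    {S : Sym2 W → Finset V} (hm : Model G H h S) : G.ContainsInducedSubdivision H := by
  obtain ⟨P, hsymm, hP⟩ := hm.exists_paths
  let s : Set V := {x | (∃ a, x = h a) ∨ ∃ (a b : W) (hab : H.Adj a b), x ∈ (P hab).support}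
  have hs : ∀ ⦃a b⦄ (hab : H.Adj a b), ∀ z ∈ (P hab).support, z ∈ s :=
    fun a b hab z hz => Or.inr ⟨a, b, hab, hz⟩
  let f : W ↪ s := ⟨fun a => ⟨h a, Or.inl ⟨a, rfl⟩⟩, fun a b hab =>
    hm.injective (congrArg Subtype.val hab)⟩
  let p : ∀ ⦃u v : W⦄, H.Adj u v → (G.induce s).Walk (f u) (f v) := fun u v huv =>
    (P huv).induce s (hs huv)
  have hsupp : ∀ ⦃u v⦄ (huv : H.Adj u v) (x : s), x ∈ (p huv).support ↔ (x : V) ∈ (P huv).support := by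
    intro u v huv x
    rw [SimpleGraph.Walk.support_induce, List.mem_attachWith]
  have hfar : ∀ (x y : V), G.Adj x y → (∃ a, x = h a) →
      (∃ (a b : W) (hab : H.Adj a b), y ∈ (P hab).support) →
      ∃ (a b : W) (hab : H.Adj a b), s(x, y) ∈ (P hab).edges := by
    rintro x y hxy ⟨a, rfl⟩ ⟨b, c, hbc, hy⟩
    refine ⟨b, c, hbc, (hP hbc).2.2 _ ?_ _ hy hxy⟩
    have hmem : a ∈ s(b, c) := by
      by_contra hna
      rcases (hP hbc).2.1 y hy with hyS | hyb | hyc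
      · exact hm.far _ hbc a hna ⟨h a, by simp, y, hyS, Or.inr hxy⟩
      · exact hm.hub a b (fun h => hna (h ▸ Sym2.mem_mk_left b c))
          ⟨h a, by simp, h b, by simp, Or.inr (hyb ▸ hxy)⟩
      · exact hm.hub a c (fun h => hna (h ▸ Sym2.mem_mk_right b c))
          ⟨h a, by simp, h c, by simp, Or.inr (hyc ▸ hxy)⟩
    rcases Sym2.mem_iff.1 hmem with rfl | rfl
    · exact SimpleGraph.Walk.start_mem_support _
    · exact SimpleGraph.Walk.end_mem_support _
  refine ⟨s, f, p, ?_, ?_, ?_, ?_, ?_, ?_⟩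
  · intro u v huv
    refine SimpleGraph.Walk.IsPath.of_map (f := (SimpleGraph.Embedding.induce s).toHom) ?_
    exact (congrArg SimpleGraph.Walk.IsPath (SimpleGraph.Walk.map_induce _ _)).mpr (hP huv).1
  · intro u v huv
    have : ∀ (q : G.Walk (h v) (h u)) (hq : ∀ z ∈ q.support, z ∈ s), q = (P huv).reverse →
        q.induce s hq = ((P huv).induce s (hs huv)).reverse := by
      rintro _ hq rfl
      exact induce_reverse _ _ _
    exact this _ _ (hsymm huv)
  · intro u v huv w hw
    rw [hsupp] at hw
    rcases (hP huv).2.1 _ hw with h1 | h1 | h1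
    · exact absurd h1 (hm.notMem _ huv w)
    · exact Or.inl (hm.injective h1)
    · exact Or.inr (hm.injective h1)
  · intro u v u' v' huv huv' hne x hx hx'
    rw [hsupp] at hx hx'
    rcases (hP huv).2.1 _ hx with h1 | h1 | h1
    · rcases (hP huv').2.1 _ hx' with h2 | h2 | h2
      · exact absurd ⟨_, h1, _, h2, Or.inl rfl⟩ (hm.sep _ huv _ huv' hne)
      · exact ⟨u', Subtype.ext h2.symm⟩
      · exact ⟨v', Subtype.ext h2.symm⟩
    · exact ⟨u, Subtype.ext h1.symm⟩
    · exact ⟨v, Subtype.ext h1.symm⟩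
  · intro x
    rcases x.2 with ⟨a, ha⟩ | ⟨a, b, hab, hx⟩
    · exact Or.inl ⟨a, Subtype.ext ha.symm⟩
    · exact Or.inr ⟨a, b, hab, (hsupp hab x).2 hx⟩
  · intro e
    induction e with
    | _ x y =>
    intro hxy
    have hadj : G.Adj x y := hxy
    suffices hsuff : ∃ (a b : W) (hab : H.Adj a b), s((x : V), (y : V)) ∈ (P hab).edges by
      obtain ⟨a, b, hab, he⟩ := hsuff
      exact ⟨a, b, hab, mk_mem_edges_induce (P hab) _ x y he⟩
    rcases x.2 with ⟨a, ha⟩ | hx <;> rcases y.2 with ⟨b, hb⟩ | hy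
    · refine absurd ⟨h a, by simp, h b, by simp, Or.inr (ha ▸ hb ▸ hadj)⟩ (hm.hub a b ?_)
      rintro rfl
      exact G.ne_of_adj hadj (ha.trans hb.symm)
    · exact hfar x y hadj ⟨a, ha⟩ hy
    · obtain ⟨a, b, hab, he⟩ := hfar y x hadj.symm ⟨b, hb⟩ hx
      exact ⟨a, b, hab, Sym2.eq_swap ▸ he⟩
    · obtain ⟨a, b, hab, hxP⟩ := hx
      obtain ⟨a', b', hab', hyP⟩ := hy
      rcases (hP hab).2.1 _ hxP with h1 | h1
      · rcases (hP hab').2.1 _ hyP with h2 | h2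
        · have heq : s(a, b) = s(a', b') := by
            by_contra hne
            exact hm.sep _ hab _ hab' hne ⟨x, h1, y, h2, Or.inr hadj⟩
          refine ⟨a, b, hab, (hP hab).2.2 _ hxP _ ?_ hadj⟩
          rcases Sym2.eq_iff.1 heq with ⟨rfl, rfl⟩ | ⟨rfl, rfl⟩
          · exact hyP
          · rwa [hsymm hab, SimpleGraph.Walk.support_reverse, List.mem_reverse] at hyP
        · obtain ⟨c, d, hcd, he⟩ := hfar y x hadj.symm
            (h2.elim (fun h => ⟨_, h⟩) fun h => ⟨_, h⟩) ⟨a, b, hab, hxP⟩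
          exact ⟨c, d, hcd, Sym2.eq_swap ▸ he⟩
      · exact hfar x y hadj (h1.elim (fun h => ⟨_, h⟩) fun h => ⟨_, h⟩) ⟨a', b', hab', hyP⟩

end

/-! ### Distances, balls and far apart cores -/

section
open scoped Classical

variable {V : Type*} {G : SimpleGraph V}

/-- `x` and `y` are at distance at most `k`. -/
def Near (G : SimpleGraph V) (k : ℕ) (x y : V) : Prop :=
  ∃ p : G.Walk x y, p.length ≤ k

theorem Near.refl (k : ℕ) (x : V) : Near G k x x :=
  ⟨SimpleGraph.Walk.nil, by simp⟩

theorem Near.symm {k : ℕ} {x y : V} (h : Near G k x y) : Near G k y x := by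
  obtain ⟨p, hp⟩ := h
  exact ⟨p.reverse, by rwa [SimpleGraph.Walk.length_reverse]⟩

theorem Near.mono {k l : ℕ} {x y : V} (h : Near G k x y) (hkl : k ≤ l) : Near G l x y := by
  obtain ⟨p, hp⟩ := h
  exact ⟨p, hp.trans hkl⟩

theorem Near.trans {k l : ℕ} {x y z : V} (h : Near G k x y) (h' : Near G l y z) :
    Near G (k + l) x z := by
  obtain ⟨p, hp⟩ := h
  obtain ⟨q, hq⟩ := h'
  exact ⟨p.append q, by rw [SimpleGraph.Walk.length_append]; omega⟩

theorem Near.of_eq_or_adj {x y : V} (h : x = y ∨ G.Adj x y) : Near G 1 x y := by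
  rcases h with rfl | h
  · exact Near.refl 1 x
  · exact ⟨h.toWalk, by simp⟩

theorem Near.of_touch {S T : Finset V} {k l : ℕ} {x y : V} (hS : ∀ u ∈ S, Near G k x u)
    (hT : ∀ u ∈ T, Near G l y u) (h : Touch G S T) : Near G (k + 1 + l) x y := by
  obtain ⟨u, hu, v, hv, huv⟩ := h
  exact ((hS u hu).trans (Near.of_eq_or_adj huv)).trans (hT v hv).symm

theorem rooted_of_near (k : ℕ) (x : V) {T : Finset V} (hT : ∀ v, v ∈ T ↔ Near G k x v) :
    Rooted G k x T := by
  refine ⟨fun v => G.dist x v, fun v hv => ?_⟩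
  obtain ⟨p, hp⟩ := (hT v).1 hv
  have hle : G.dist x v ≤ k := (SimpleGraph.dist_le p).trans hp
  refine ⟨hle, ?_⟩
  obtain ⟨q, hq⟩ := p.reverse.reachable.exists_walk_length_eq_dist
  cases q with
  | nil => exact Or.inl rfl
  | @cons _ u _ h q =>
    rw [SimpleGraph.Walk.length_cons, SimpleGraph.dist_comm] at hq
    have hq' := SimpleGraph.dist_le q.reverse
    rw [SimpleGraph.Walk.length_reverse] at hq'
    refine Or.inr ⟨u, (hT u).2 ⟨q.reverse, ?_⟩, h.symm, ?_⟩
    · rw [SimpleGraph.Walk.length_reverse]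
      omega
    · change G.dist x u < G.dist x v
      omega

/-- In a coherent graph every set with at least `3m` elements includes a connected set, given as a
rooted set, with at least `m` elements. -/
theorem Coherent.exists_rooted {Z : Finset V} {m : ℕ} (hcoh : Coherent G Z m) (hm : 1 ≤ m)
    {W : Finset V} (hWZ : W ⊆ Z) (hW : 3 * m ≤ W.card) :
    ∃ r x, ∃ T ⊆ W, Rooted G r x T ∧ m ≤ T.card := by
  let closed : Finset V → Prop := fun S =>
    S ⊆ W ∧ m ≤ S.card ∧ ∀ u ∈ S, ∀ v ∈ W, G.Adj u v → v ∈ S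
  -- S is a smallest union of components of W with at least m vertices. If it were not a single
  -- component, both parts would have fewer than m vertices, leaving more than m vertices of W
  -- outside S and not touching it.
  obtain ⟨S, hS, hmin⟩ := Finset.exists_min_image (W.powerset.filter closed) Finset.card
    ⟨W, Finset.mem_filter.2 ⟨Finset.mem_powerset_self W, subset_rfl, by omega,
      fun _ _ v hv _ => hv⟩⟩
  obtain ⟨hSW, hSm, hScl⟩ := (Finset.mem_filter.1 hS).2
  have hsmall : ∀ S' ⊆ S, (∀ u ∈ S', ∀ v ∈ S, G.Adj u v → v ∈ S') → S' ≠ S → S'.card < m := by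
    intro S' hS' hcl hne
    by_contra! hcard
    have := hmin S' (Finset.mem_filter.2 ⟨Finset.mem_powerset.2 (hS'.trans hSW),
      hS'.trans hSW, hcard, fun u hu v hv huv => hcl u hu v (hScl u (hS' hu) v hv huv) huv⟩)
    exact hne (Finset.eq_of_subset_of_card_le hS' this)
  obtain ⟨x, hx⟩ : S.Nonempty := Finset.card_pos.1 (by omega)
  obtain ⟨T, hT, hmax⟩ := Finset.exists_max_image
    (S.powerset.filter fun T => x ∈ T ∧ ∃ r, Rooted G r x T) Finset.card
    ⟨{x}, by
      refine Finset.mem_filter.2 ⟨by simpa using hx, by simp, 0, fun _ => 0, fun v hv => ?_⟩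
      exact ⟨le_rfl, Or.inl (Finset.mem_singleton.1 hv)⟩⟩
  obtain ⟨hTS, hxT, r, hr⟩ := Finset.mem_filter.1 hT
  rw [Finset.mem_powerset] at hTS
  have hTcl : ∀ u ∈ T, ∀ v ∈ S, G.Adj u v → v ∈ T := by
    intro u hu v hv huv
    by_contra hvT
    have := hmax (Insert.insert v T) (Finset.mem_filter.2
      ⟨Finset.mem_powerset.2 (Finset.insert_subset hv hTS), Finset.mem_insert_of_mem hxT,
        r + 1, hr.insert hu hvT huv⟩)
    rw [Finset.card_insert_of_notMem hvT] at this
    omega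
  by_cases hne : T = S
  · exact ⟨r, x, T, hTS.trans hSW, hr, hne ▸ hSm⟩
  have h1 := hsmall T hTS hTcl hne
  have h2 : (S \ T).card < m := by
    refine hsmall _ Finset.sdiff_subset (fun u hu v hv huv => ?_) fun h => ?_
    · rw [Finset.mem_sdiff] at hu ⊢
      exact ⟨hv, fun hvT => hu.2 (hTcl v hvT u hu.1 huv.symm)⟩
    · rw [Finset.sdiff_eq_self_iff_disjoint] at h
      exact Finset.disjoint_left.1 h hx hxT
  have h3 := Finset.card_sdiff_add_card_eq_card hTS
  have h4 := Finset.card_sdiff_add_card_eq_card hSW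
  obtain ⟨u, hu, v, hv, huv⟩ := hcoh S (hSW.trans hWZ) (W \ S)
    (Finset.sdiff_subset.trans hWZ) hSm (by omega)
  rw [Finset.mem_sdiff] at hv
  rcases huv with rfl | huv
  · exact absurd hu hv.2
  · exact absurd (hScl u hu v hv.1 huv) hv.2

variable [Fintype V]

/-- The set of vertices at distance at most `k` from `S`. -/
noncomputable def ball (G : SimpleGraph V) (k : ℕ) (S : Finset V) : Finset V :=
  Finset.univ.filter fun v => ∃ u ∈ S, Near G k u v

theorem mem_ball {k : ℕ} {S : Finset V} {v : V} : v ∈ ball G k S ↔ ∃ u ∈ S, Near G k u v := by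
  simp [ball]

theorem rooted_ball (k : ℕ) (x : V) : Rooted G k x (ball G k {x}) :=
  rooted_of_near k x fun v => by simp [mem_ball]

/-- A connected set `U` whose neighbourhood at distance `k + 1` reaches almost every vertex, while few
vertices are at distance at most `k`. -/
theorem exists_core {m : ℕ} (hcoh : Coherent G Finset.univ m) (hm : 1 ≤ m) {k : ℕ}
    (hball : ∀ x, (ball G k {x}).card < m) {W : Finset V} (hW : 3 * m ≤ W.card) :
    ∃ U ⊆ W, U.Nonempty ∧ Conn G U ∧ (ball G k U).card < 2 * m ∧
      (Finset.univ \ ball G (k + 1) U).card < m := by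
  obtain ⟨r, x, T₀, hT₀, hr₀, hcard₀⟩ := hcoh.exists_rooted hm (Finset.subset_univ W) hW
  -- Minimality bounds the k-ball of T from above: erasing one vertex brings it below m, and a
  -- single vertex has a k-ball below m. Having at least m vertices, this k-ball touches every
  -- m-set, so the (k+1)-ball misses fewer than m vertices.
  obtain ⟨T, hT, hmin⟩ := Finset.exists_min_image
    (W.powerset.filter fun T => Rooted G r x T ∧ m ≤ (ball G k T).card) Finset.card
    ⟨T₀, Finset.mem_filter.2 ⟨Finset.mem_powerset.2 hT₀, hr₀, hcard₀.trans
      (Finset.card_le_card fun v hv => mem_ball.2 ⟨v, hv, Near.refl k v⟩)⟩⟩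
  obtain ⟨hTW, hr, hcard⟩ := Finset.mem_filter.1 hT
  rw [Finset.mem_powerset] at hTW
  have hne : T.Nonempty := by
    rw [Finset.nonempty_iff_ne_empty]
    rintro rfl
    have : ball G k ∅ = ∅ := by simp [ball]
    rw [this, Finset.card_empty] at hcard
    omega
  refine ⟨T, hTW, hne, hr.conn, ?_, ?_⟩
  · obtain ⟨v, hv, hr'⟩ := hr.exists_erase hne
    have h1 : (ball G k (T.erase v)).card < m := by
      by_contra! h
      have := hmin (T.erase v) (Finset.mem_filter.2
        ⟨Finset.mem_powerset.2 ((Finset.erase_subset _ _).trans hTW), hr', h⟩)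
      have := Finset.card_erase_lt_of_mem hv
      omega
    have h2 : ball G k T ⊆ ball G k (T.erase v) ∪ ball G k {v} := by
      intro w hw
      obtain ⟨u, hu, huw⟩ := mem_ball.1 hw
      rw [Finset.mem_union, mem_ball, mem_ball]
      by_cases huv : u = v
      · exact Or.inr ⟨u, by simp [huv], huw⟩
      · exact Or.inl ⟨u, Finset.mem_erase.2 ⟨huv, hu⟩, huw⟩
    have h3 := (Finset.card_le_card h2).trans (Finset.card_union_le _ _)
    have h4 := hball v
    omega
  · by_contra! h
    obtain ⟨u, hu, v, hv, huv⟩ := hcoh _ (Finset.subset_univ _) _ (Finset.subset_univ _) hcard h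
    obtain ⟨w, hw, hwu⟩ := mem_ball.1 hu
    exact (Finset.mem_sdiff.1 hv).2 (mem_ball.2 ⟨w, hw, hwu.trans (Near.of_eq_or_adj huv)⟩)

/-- Each core is found inside the vertices still available, hence far from earlier cores. It then
removes fewer than 3m of them: fewer than 2m within distance 2 and fewer than m beyond distance 3.
-/
theorem exists_cores {m : ℕ} (hcoh : Coherent G Finset.univ m) (hm : 1 ≤ m)
    (hball : ∀ x, (ball G 2 {x}).card < m) (k : ℕ) (hk : 3 * m * k ≤ Fintype.card V) :
    ∃ (U : ℕ → Finset V) (W : Finset V), Fintype.card V ≤ W.card + 3 * m * k ∧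
      (∀ s < k, (U s).Nonempty ∧ Conn G (U s)) ∧
      (∀ s < k, ∀ s' < s, ∀ u ∈ U s, ∀ u' ∈ U s', ¬ Near G 2 u' u) ∧
      ∀ z ∈ W, ∀ s < k, (∃ u ∈ U s, Near G 3 u z) ∧ ∀ u ∈ U s, ¬ Near G 2 u z := by
  induction k with
  | zero => exact ⟨fun _ => ∅, Finset.univ, by simp, by simp, by simp, by simp⟩
  | succ k ih =>
    rw [Nat.mul_succ] at hk
    obtain ⟨U, W, h1, h2, h3, h4⟩ := ih (by omega)
    obtain ⟨U', hU'W, hne, hconn, hsmall, hlarge⟩ := exists_core hcoh hm hball (W := W) (by omega)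
    have hlt : ∀ s < k, Function.update U k U' s = U s := fun s hs =>
      Function.update_of_ne (by omega) _ _
    have heq : Function.update U k U' k = U' := Function.update_self _ _ _
    refine ⟨Function.update U k U', (W \ ball G 2 U') \ (Finset.univ \ ball G 3 U'), ?_, ?_, ?_, ?_⟩
    · have h5 := Finset.le_card_sdiff (ball G 2 U') W
      have h6 := Finset.le_card_sdiff (Finset.univ \ ball G 3 U') (W \ ball G 2 U')
      have h7 : (Finset.univ \ ball G 3 U').card < m := hlarge
      rw [Nat.mul_succ]
      omega
    · intro s hs
      rcases Nat.lt_succ_iff_lt_or_eq.1 hs with hs | rfl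
      · rw [hlt s hs]
        exact h2 s hs
      · rw [heq]
        exact ⟨hne, hconn⟩
    · intro s hs s' hs'
      rcases Nat.lt_succ_iff_lt_or_eq.1 hs with hs | rfl
      · rw [hlt s hs, hlt s' (hs'.trans hs)]
        exact h3 s hs s' hs'
      · rw [heq, hlt s' hs']
        exact fun u hu => (h4 u (hU'W hu) s' hs').2
    · intro z hz s hs
      simp only [Finset.mem_sdiff, Finset.mem_univ, true_and, not_not] at hz
      rcases Nat.lt_succ_iff_lt_or_eq.1 hs with hs | rfl
      · rw [hlt s hs]
        exact h4 z hz.1.1 s hs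
      · rw [heq]
        exact ⟨mem_ball.1 hz.2, fun u hu hz' => hz.1.2 (mem_ball.2 ⟨u, hu, hz'⟩)⟩

/-- Far apart connected sets `U s` and, for most vertices `z`, short paths from `z` to each `U s`. -/
theorem exists_cores_paths {m : ℕ} (hcoh : Coherent G Finset.univ m) (hm : 1 ≤ m)
    (hball : ∀ x, (ball G 2 {x}).card < m) (k : ℕ) (hk : 3 * m * k ≤ Fintype.card V) :
    ∃ (U : Fin k → Finset V) (Q : Fin k → V → Finset V) (W : Finset V),
      Fintype.card V ≤ W.card + 3 * m * k ∧
      (∀ s, (U s).Nonempty ∧ Conn G (U s)) ∧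
      (∀ s s', s ≠ s' → ¬ Touch G (U s) (U s')) ∧
      (∀ s, ∀ z ∈ W, Conn G (Q s z) ∧ z ∈ Q s z ∧ (∃ u ∈ Q s z, u ∈ U s) ∧ (Q s z).card ≤ 4 ∧
        ∀ y ∈ Q s z, Near G 3 z y) ∧
      ∀ s s', s ≠ s' → ∀ z ∈ W, ¬ Touch G (Q s z) (U s') := by
  obtain ⟨U, W, h1, h2, h3, h4⟩ := exists_cores hcoh hm hball k hk
  have hfar : ∀ s s' : Fin k, s ≠ s' → ∀ u ∈ U s, ∀ u' ∈ U s', ¬ Near G 2 u u' := by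
    intro s s' hne u hu u' hu' hnear
    rcases lt_or_gt_of_ne hne with h | h
    · exact h3 s' s'.2 s h u' hu' u hu hnear
    · exact h3 s s.2 s' h u hu u' hu' hnear.symm
  have hpath : ∀ (s : Fin k) (z : V), ∃ Q : Finset V, z ∈ W → Conn G Q ∧ z ∈ Q ∧
      (∃ u ∈ Q, u ∈ U s ∧ ∀ y ∈ Q, ∃ i j, i + j ≤ 3 ∧ Near G i z y ∧ Near G j y u) ∧
      Q.card ≤ 4 := by
    intro s z
    by_cases hz : z ∈ W
    · obtain ⟨u, hu, hnear⟩ := (h4 z hz s s.2).1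
      obtain ⟨p, hp⟩ := hnear.symm
      refine ⟨p.support.toFinset, fun _ => ⟨?_, by simp, ⟨u, by simp, hu, fun y hy => ?_⟩, ?_⟩⟩
      · refine Conn.of_center (c := u) fun x hx => ?_
        rw [List.mem_toFinset] at hx
        exact ⟨p.dropUntil x hx, fun w hw => List.mem_toFinset.2
          (p.support_dropUntil_subset_support hx hw)⟩
      · rw [List.mem_toFinset] at hy
        refine ⟨_, _, ?_, ⟨p.takeUntil y hy, le_rfl⟩, ⟨p.dropUntil y hy, le_rfl⟩⟩
        rw [← SimpleGraph.Walk.length_append, SimpleGraph.Walk.take_spec]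
        exact hp
      · refine (List.toFinset_card_le _).trans ?_
        rw [SimpleGraph.Walk.length_support]
        omega
    · exact ⟨∅, fun h => absurd h hz⟩
  choose Q hQ using hpath
  refine ⟨fun s => U s, Q, W, h1, fun s => h2 s s.2, ?_, ?_, ?_⟩
  · rintro s s' hne ⟨u, hu, u', hu', huu'⟩
    exact hfar s s' hne u hu u' hu' ((Near.of_eq_or_adj huu').mono (by omega))
  · intro s z hz
    obtain ⟨hc, hzQ, ⟨u, huQ, hu, hy⟩, hcard⟩ := hQ s z hz
    refine ⟨hc, hzQ, ⟨u, huQ, hu⟩, hcard, fun y hyQ => ?_⟩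
    obtain ⟨i, j, hij, hi, -⟩ := hy y hyQ
    exact hi.mono (by omega)
  · rintro s s' hne z hz ⟨y, hy, u', hu', hyu⟩
    obtain ⟨hc, hzQ, ⟨u, huQ, hu, hyQ⟩, hcard⟩ := hQ s z hz
    obtain ⟨i, j, hij, hi, hj⟩ := hyQ y hy
    have hnear := Near.of_eq_or_adj hyu
    -- A path vertex y adjacent or equal to a vertex of another core is within 1 of its own core,
    -- putting two cores within distance 2, or within 1 of z, putting z within distance 2 of a core.
    by_cases hj1 : j ≤ 1
    · exact hfar s s' hne u hu u' hu' ((hj.symm.trans hnear).mono (by omega))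
    · exact (h4 z hz s' s'.2).2 u' hu' ((hi.trans hnear).symm.mono (by omega))

end

/-! ### First case: large trees of bounded height -/

section
open scoped Classical

variable {V : Type*} {G : SimpleGraph V}

/-- If every large set includes a large rooted set of bounded height, then there is a model. -/
theorem exists_model_of_rooted [Fintype V] {W : Type*} [Fintype W] (H : SimpleGraph W)
    {m M r : ℕ} (hcoh : Coherent G Finset.univ m)
    (hdeg : ∀ x, (Finset.univ.filter (G.Adj x)).card ≤ m) (hM : 2 * m ≤ M) (hMpos : 0 < M)
    (hroot : ∀ X : Finset V, 3 * M ≤ X.card → ∃ T ⊆ X, (∃ x, Rooted G r x T) ∧ m ≤ T.card)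
    (hMW : Fintype.card W * (2 * ((Fintype.card (Sym2 W) * (r + 1) + 1) * m) + 1) ≤ 3 * M)
    (hV : 2 ^ Fintype.card (Sym2 W) * (3 ^ 2 ^ Fintype.card (Sym2 W) * M) ≤ Fintype.card V) :
    ∃ h S, Model G H h S := by
  obtain ⟨A, -, D, hA, hD, hDT, hDsep⟩ := exists_common_target hcoh (fun x _ => hdeg x) hM hMpos
    (F := fun T => ∃ x, Rooted G r x T) (fun T hT hne => by
      obtain ⟨x, hx⟩ := hT
      obtain ⟨v, hv, hv'⟩ := hx.exists_erase hne
      exact ⟨v, hv, x, hv'⟩) (fun X _ hX => hroot X hX) (Fintype.card (Sym2 W)) hV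
  have hAne : A.Nonempty := Finset.card_pos.1 (by omega)
  obtain ⟨T⟩ : Nonempty (Sym2 W ↪ D) :=
    Function.Embedding.nonempty_of_card_le (by rwa [Fintype.card_coe])
  have hroots : ∀ e, ∃ x, Rooted G r x (T e : Finset V) := fun e => (hDT _ (T e).2).1
  choose x hx using hroots
  have hpath : ∀ e v, ∃ P : Finset V, v ∈ A → P ⊆ (T e : Finset V) ∧ (∃ u ∈ P, G.Adj u v) ∧
      x e ∈ P ∧ P.card ≤ r + 1 ∧ Conn G P := by
    intro e v
    by_cases hv : v ∈ A
    · obtain ⟨u, hu, huv⟩ := (hDT _ (T e).2).2.2.2 v hv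
      obtain ⟨P, hP, huP, hxP, hcard, hconn⟩ := (hx e).exists_path hu
      exact ⟨P, fun _ => ⟨hP, ⟨u, huP, huv⟩, hxP, hcard, hconn⟩⟩
    · exact ⟨∅, fun h => absurd h hv⟩
  choose P hP using hpath
  -- A candidate hub v together with its route to each root has at most `Fintype.card (Sym2 W) * (r
  -- + 1) + 1` vertices, each with at most m neighbours; chosen hubs avoid these neighbours.
  obtain ⟨h, hhA, hh⟩ := exists_independent (W := W) (A := A)
    (R := fun v v' => ∃ u ∈ Insert.insert v (Finset.univ.biUnion fun e => P e v), G.Adj u v')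
    (d := (Fintype.card (Sym2 W) * (r + 1) + 1) * m) (by
      intro v hv
      refine (Finset.card_le_card (t := (Insert.insert v (Finset.univ.biUnion fun e => P e v)).biUnion
        fun u => Finset.univ.filter (G.Adj u)) fun v' hv' => ?_).trans ?_
      · simp only [Finset.mem_filter] at hv'
        obtain ⟨u, hu, huv⟩ := hv'.2
        exact Finset.mem_biUnion.2 ⟨u, hu, Finset.mem_filter.2 ⟨Finset.mem_univ _, huv⟩⟩
      · refine (Finset.card_biUnion_le_card_mul _ _ m fun u _ => hdeg u).trans
          (Nat.mul_le_mul_right m ((Finset.card_insert_le _ _).trans ?_))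
        exact Nat.succ_le_succ (Finset.card_biUnion_le_card_mul _ _ (r + 1)
          fun e _ => (hP e v hv).2.2.2.1)) (hMW.trans hA)
  have hnadj : ∀ a b, ¬ G.Adj (h a) (h b) := by
    intro a b hab
    by_cases hne : a = b
    · subst hne
      exact G.loopless.irrefl _ hab
    · exact (hh a b hne).2 ⟨h a, Finset.mem_insert_self _ _, hab⟩
  have hST : ∀ e, (Finset.univ.filter fun a => a ∈ e).biUnion (fun a => P e (h a)) ⊆
      (T e : Finset V) := fun e =>
    Finset.biUnion_subset.2 fun a _ => (hP e (h a) (hhA a)).1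
  have hnotMem : ∀ e a, h a ∉ (T e : Finset V) := fun e a ha =>
    Finset.disjoint_left.1 (hDT _ (T e).2).2.2.1 ha (hhA a)
  refine ⟨h, fun e => (Finset.univ.filter fun a => a ∈ e).biUnion fun a => P e (h a),
    ?_, ?_, ?_, ?_, ?_, ?_⟩
  · rintro a b hab ⟨x, hx, y, hy, hxy⟩
    rw [Finset.mem_singleton] at hx hy
    subst hx hy
    exact hxy.elim (hh a b hab).1 (hnadj a b)
  · intro e _
    refine Conn.of_center (c := x e) fun y hy => ?_
    obtain ⟨a, ha, hy⟩ := Finset.mem_biUnion.1 hy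
    obtain ⟨-, -, hxP, -, hconn⟩ := hP e (h a) (hhA a)
    obtain ⟨p, hp⟩ := hconn y hy (x e) hxP
    exact ⟨p, fun z hz => Finset.mem_biUnion.2 ⟨a, ha, hp z hz⟩⟩
  · intro e _ a ha
    obtain ⟨u, hu, hua⟩ := (hP e (h a) (hhA a)).2.1
    exact ⟨u, Finset.mem_biUnion.2 ⟨a, by simpa using ha, hu⟩, hua⟩
  · exact fun e _ a ha => hnotMem e a (hST e ha)
  · rintro e - a ha ⟨x, hx, y, hy, hxy⟩
    rw [Finset.mem_singleton] at hx
    subst hx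
    rcases hxy with rfl | hxy
    · exact hnotMem e a (hST e hy)
    · obtain ⟨b, hb, hy⟩ := Finset.mem_biUnion.1 hy
      refine (hh b a ?_).2 ⟨y, Finset.mem_insert_of_mem (Finset.mem_biUnion.2
        ⟨e, Finset.mem_univ _, hy⟩), hxy.symm⟩
      rintro rfl
      exact ha (Finset.mem_filter.1 hb).2
  · intro e _ e' _ hne ht
    exact hDsep _ (T e).2 _ (T e').2 (fun h => hne (T.injective (Subtype.ext h)))
      (ht.mono (hST e) (hST e'))

end

/-! ### Second case: all balls of radius 21 are small -/

section
open scoped Classical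

variable {V : Type*} {G : SimpleGraph V}

/-- The graph in which two vertices are adjacent if their sets `Y` touch. -/
def touchGraph (G : SimpleGraph V) (Y : V → Finset V) : SimpleGraph V where
  Adj x y := x ≠ y ∧ Touch G (Y x) (Y y)
  symm := ⟨fun _ _ h => ⟨h.1.symm, h.2.symm⟩⟩
  loopless := ⟨fun _ h => h.1 rfl⟩

/-- Hubs `y a`, with `K` legs each, assembled with cores `U s` into a model. -/
theorem exists_model_of_legs {W : Type*} [Fintype W] (H : SimpleGraph W) {k : ℕ}
    (hk : Fintype.card (Sym2 W) + 2 * Fintype.card W ≤ k)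
    {U : Fin k → Finset V} {Q : Fin k → V → Finset V} {X : Finset V}
    (hU : ∀ s, (U s).Nonempty ∧ Conn G (U s))
    (hUU : ∀ s s', s ≠ s' → ¬ Touch G (U s) (U s'))
    (hQ : ∀ s, ∀ z ∈ X, Conn G (Q s z) ∧ z ∈ Q s z ∧ ∃ u ∈ Q s z, u ∈ U s)
    (hQU : ∀ s s', s ≠ s' → ∀ z ∈ X, ¬ Touch G (Q s z) (U s'))
    {y : W → V} {s₀ s₁ : W → Fin k} {c : W → Sym2 W → V} (hc : ∀ a e, c a e ∈ X)
    (hyU : ∀ a s, s ≠ s₀ a → ¬ Touch G {y a} (U s))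
    (hyy : ∀ a b, a ≠ b → ¬ Touch G {y a} {y b})
    (hadj : ∀ a e, ∃ w ∈ Q (s₁ a) (c a e), G.Adj w (y a))
    (hyc : ∀ a e s, y a ∉ Q s (c a e))
    (hyc' : ∀ a b e s, a ≠ b → ¬ Touch G {y a} (Q s (c b e)))
    (hcc : ∀ a b e e' s s', e ≠ e' → ¬ Touch G (Q s (c a e)) (Q s' (c b e'))) :
    ∃ h S, Model G H h S := by
  -- Hub a may touch the core `s₀ a`, and its legs start along paths leading to the core `s₁ a`. The
  -- bound on k leaves one other core for each edge.
  let bad : Finset (Fin k) := Finset.univ.image s₀ ∪ Finset.univ.image s₁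
  have hbad : Fintype.card (Sym2 W) ≤ (Finset.univ \ bad).card := by
    have h1 := Finset.le_card_sdiff bad Finset.univ
    have h2 := Finset.card_union_le (Finset.univ.image s₀) (Finset.univ.image s₁)
    have h3 := Finset.card_image_le (s := Finset.univ) (f := s₀)
    have h4 := Finset.card_image_le (s := Finset.univ) (f := s₁)
    rw [Finset.card_univ] at h3 h4
    rw [Finset.card_univ, Fintype.card_fin] at h1
    change _ - (Finset.univ.image s₀ ∪ Finset.univ.image s₁).card ≤ _ at h1
    omega
  obtain ⟨σ⟩ : Nonempty (Sym2 W ↪ (Finset.univ \ bad : Finset (Fin k))) :=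
    Function.Embedding.nonempty_of_card_le (by rwa [Fintype.card_coe])
  have hσ₀ : ∀ e a, (σ e : Fin k) ≠ s₀ a := fun e a h => (Finset.mem_sdiff.1 (σ e).2).2
    (Finset.mem_union_left _ (Finset.mem_image.2 ⟨a, Finset.mem_univ _, h.symm⟩))
  have hσ₁ : ∀ e a, s₁ a ≠ (σ e : Fin k) := fun e a h => (Finset.mem_sdiff.1 (σ e).2).2
    (Finset.mem_union_right _ (Finset.mem_image.2 ⟨a, Finset.mem_univ _, h⟩))
  have hσ : ∀ e e', e ≠ e' → (σ e : Fin k) ≠ σ e' := fun e e' hne h =>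
    hne (σ.injective (Subtype.ext h))
  -- From the hub the leg follows its `s₁ a` path to the centre `c a e`, then the path from there to
  -- the core reserved for e.
  let S : Sym2 W → Finset V := fun e => U (σ e) ∪
    (Finset.univ.filter fun a => a ∈ e).biUnion fun a => Q (s₁ a) (c a e) ∪ Q (σ e) (c a e)
  have hS : ∀ e v, v ∈ S e → v ∈ U (σ e) ∨
      ∃ a ∈ e, ∃ s : Fin k, (∀ e', e ≠ e' → s ≠ (σ e' : Fin k)) ∧ v ∈ Q s (c a e) := by
    intro e v hv
    refine (Finset.mem_union.1 hv).imp id fun hv => ?_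
    obtain ⟨a, ha, hv⟩ := Finset.mem_biUnion.1 hv
    refine ⟨a, (Finset.mem_filter.1 ha).2, ?_⟩
    rcases Finset.mem_union.1 hv with hv | hv
    · exact ⟨_, fun e' _ => hσ₁ e' a, hv⟩
    · exact ⟨_, fun e' hne => hσ e e' hne, hv⟩
  refine ⟨y, S, hyy, ?_, ?_, ?_, ?_, ?_⟩
  · intro e _
    obtain ⟨x, hx⟩ := (hU (σ e)).1
    refine (hU (σ e)).2.union_biUnion hx fun a _ => ?_
    obtain ⟨h1, h2, -⟩ := hQ (s₁ a) (c a e) (hc a e)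
    obtain ⟨h3, h4, u, hu, huU⟩ := hQ (σ e) (c a e) (hc a e)
    exact ⟨h1.union h3 h2 h4, u, Finset.mem_union_right _ hu, huU⟩
  · intro e _ a ha
    obtain ⟨w, hw, hwa⟩ := hadj a e
    exact ⟨w, Finset.mem_union_right _ (Finset.mem_biUnion.2 ⟨a, by simpa using ha,
      Finset.mem_union_left _ hw⟩), hwa⟩
  · intro e _ a ha
    rcases hS e _ ha with h | ⟨b, -, s, -, h⟩
    · exact hyU a (σ e) (hσ₀ e a) ⟨y a, by simp, y a, h, Or.inl rfl⟩
    · by_cases hab : a = b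
      · subst hab
        exact hyc a e s h
      · exact hyc' a b e s hab ⟨y a, by simp, y a, h, Or.inl rfl⟩
  · rintro e - a ha ⟨x, hx, v, hv, hxv⟩
    rcases hS e _ hv with h | ⟨b, hb, s, -, h⟩
    · exact hyU a (σ e) (hσ₀ e a) ⟨x, hx, v, h, hxv⟩
    · exact hyc' a b e s (fun hab => ha (hab ▸ hb)) ⟨x, hx, v, h, hxv⟩
  · rintro e - e' - hne ⟨x, hx, v, hv, hxv⟩
    rcases hS e _ hx with h | ⟨a, ha, s, hs, h⟩ <;> rcases hS e' _ hv with h' | ⟨b, hb, s', hs', h'⟩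
    · exact hUU _ _ (hσ e e' hne) ⟨x, h, v, h', hxv⟩
    · exact hQU s' (σ e) (hs' e hne.symm) _ (hc b e') (Touch.symm ⟨x, h, v, h', hxv⟩)
    · exact hQU s (σ e') (hs e' hne) _ (hc a e) ⟨x, h, v, h', hxv⟩
    · exact hcc a b e e' s s' hne ⟨x, h, v, h', hxv⟩

/-- Many legs at one vertex: some `K + 1` of them attach to the same point along the same index. -/
theorem exists_common_attachment {ι : Type*} {k K n : ℕ} {J : Finset ι} {Y : Finset V}
    {Q : Fin k → ι → Finset V} (hY : Y.card ≤ n) (hJ : n * k * K < J.card)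
    (h : ∀ j ∈ J, ∃ y ∈ Y, ∃ s, ∃ w ∈ Q s j, y = w ∨ G.Adj y w) :
    ∃ y ∈ Y, ∃ s, ∃ J' ⊆ J, K < J'.card ∧ ∀ j ∈ J', ∃ w ∈ Q s j, y = w ∨ G.Adj y w := by
  obtain ⟨j₀, hj₀⟩ : J.Nonempty := Finset.card_pos.1 (by omega)
  obtain ⟨y₀, -, s₀, -⟩ := h j₀ hj₀
  have : Nonempty V := ⟨y₀⟩
  have : Nonempty (Fin k) := ⟨s₀⟩
  choose! y hy s w hw hyw using h
  obtain ⟨p, hp, hcard⟩ := Finset.exists_lt_card_fiber_of_mul_lt_card_of_maps_to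
    (s := J) (t := Y ×ˢ (Finset.univ : Finset (Fin k))) (f := fun j => (y j, s j)) (n := K)
    (fun j hj => Finset.mem_product.2 ⟨hy j hj, Finset.mem_univ _⟩) (by
      rw [Finset.card_product, Finset.card_univ, Fintype.card_fin]
      exact (Nat.mul_le_mul_right _ (Nat.mul_le_mul_right _ hY)).trans_lt hJ)
  refine ⟨p.1, (Finset.mem_product.1 hp).1, p.2, _, Finset.filter_subset _ _, hcard, fun j hj => ?_⟩
  obtain ⟨hjJ, rfl⟩ := Finset.mem_filter.1 hj
  exact ⟨w j, hw j hjJ, hyw j hjJ⟩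

/-- If every rooted set of height at most `21` is small, then there is a model. -/
theorem exists_model_of_not_rooted [Fintype V] {W : Type*} [Fintype W] (H : SimpleGraph W)
    {m k K : ℕ} (hcoh : Coherent G Finset.univ m) (hm : 1 ≤ m)
    (hroot : ∀ (x : V) (T : Finset V), Rooted G 21 x T → T.card < m)
    (hkpos : 0 < k) (hk : Fintype.card (Sym2 W) + 2 * Fintype.card W ≤ k)
    (hK : k * 4 * k * (Fintype.card (Sym2 W) + 1) < K)
    (hV : 2 ^ K * (3 ^ 2 ^ K * ((Fintype.card W + 2) * m)) + 3 * m * k ≤ Fintype.card V) :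
    ∃ h S, Model G H h S := by
  have hball : ∀ {l : ℕ} (x : V), l ≤ 21 → (ball G l {x}).card < m := fun x hl =>
    hroot x _ ((rooted_ball _ x).mono hl)
  obtain ⟨U, Q, X, hX, hU, hUU, hQ, hQU⟩ := exists_cores_paths hcoh hm
    (fun x => hball x (by norm_num)) k (by omega)
  let Y : V → Finset V := fun z => Finset.univ.biUnion fun s => Q s z
  have hQY : ∀ s z, Q s z ⊆ Y z := fun s z => Finset.subset_biUnion_of_mem (fun s => Q s z)
    (Finset.mem_univ s)
  have hYnear : ∀ z ∈ X, ∀ u ∈ Y z, Near G 3 z u := by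
    intro z hz u hu
    obtain ⟨s, -, hu⟩ := Finset.mem_biUnion.1 hu
    exact (hQ s z hz).2.2.2.2 u hu
  have hYcard : ∀ z ∈ X, (Y z).card ≤ k * 4 := by
    intro z hz
    refine (Finset.card_biUnion_le_card_mul _ _ 4 fun s _ => (hQ s z hz).2.2.2.1).trans ?_
    rw [Finset.card_univ, Fintype.card_fin]
  have hYself : ∀ z ∈ X, z ∈ Y z := fun z hz => hQY ⟨0, hkpos⟩ z (hQ _ z hz).2.1
  have hYtouch : ∀ z ∈ X, ∀ z' ∈ X, Touch G (Y z) (Y z') → Near G 7 z z' := fun z hz z' hz' h =>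
    Near.of_touch (hYnear z hz) (hYnear z' hz') h
  have hcoh' : Coherent (touchGraph G Y) X m := by
    intro A hA B hB hAm hBm
    obtain ⟨a, ha, b, hb, hab⟩ := hcoh A (Finset.subset_univ A) B (Finset.subset_univ B) hAm hBm
    refine ⟨a, ha, b, hb, or_iff_not_imp_left.2 fun hne => ⟨hne, ?_⟩⟩
    exact ⟨a, hYself a (hA ha), b, hYself b (hB hb), hab⟩
  have hdeg : ∀ x ∈ X, (X.filter ((touchGraph G Y).Adj x)).card ≤ m := by
    intro x hx
    refine (Finset.card_le_card (t := ball G 7 {x}) fun z hz => ?_).trans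
      (hball x (by norm_num)).le
    obtain ⟨hz, hxz⟩ := Finset.mem_filter.1 hz
    exact mem_ball.2 ⟨x, by simp, hYtouch x hx z hz hxz.2⟩
  -- In the touch graph single vertices already stand for connected sets, so all sets are admitted
  -- as family members.
  obtain ⟨A, hAX, D, hA, hD, hDT, hDsep⟩ := exists_common_target hcoh' hdeg
    (M := (Fintype.card W + 2) * m) (Nat.mul_le_mul_right m (by omega)) (by positivity)
    (F := fun _ => True) (fun T _ hT => ⟨_, hT.choose_spec, trivial⟩)
    (fun Z _ hZ => ⟨Z, subset_rfl, trivial, by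
      have := Nat.mul_le_mul_right m (show 1 ≤ Fintype.card W + 2 by omega)
      omega⟩) K (by omega)
  have hleg : ∀ (T : D) (v : V), ∃ c, v ∈ A → c ∈ (T : Finset V) ∧ (touchGraph G Y).Adj c v := by
    intro T v
    by_cases hv : v ∈ A
    · obtain ⟨c, hc⟩ := (hDT _ T.2).2.2.2 v hv
      exact ⟨c, fun _ => hc⟩
    · exact ⟨v, fun h => absurd h hv⟩
  choose c hc using hleg
  have hcX : ∀ T, ∀ v ∈ A, c T v ∈ X := fun T v hv => (hDT _ T.2).2.1 (hc T v hv).1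
  have hcc : ∀ T T', T ≠ T' → ∀ v ∈ A, ∀ v' ∈ A, ¬ Touch G (Y (c T v)) (Y (c T' v')) := by
    intro T T' hne v hv v' hv' ht
    refine hDsep _ T.2 _ T'.2 (fun h => hne (Subtype.ext h))
      ⟨_, (hc T v hv).1, _, (hc T' v' hv').1, or_iff_not_imp_left.2 fun h => ⟨h, ht⟩⟩
  have hcnear : ∀ T, ∀ v ∈ A, ∀ u ∈ Y (c T v), Near G 10 v u := fun T v hv u hu =>
    (hYtouch v (hAX hv) _ (hcX T v hv) (hc T v hv).2.2.symm).trans (hYnear _ (hcX T v hv) u hu)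
  -- Sets Y reach distance 3, so touching ones have centres within 3 + 1 + 3 = 7, and a leg at v
  -- lies within 7 + 3 = 10 of v. Legs at centres more than 10 + 1 + 10 = 21 apart cannot touch.
  obtain ⟨v, hvA, hv⟩ := exists_independent (W := W) (A := A) (R := Near G 21) (d := m) (by
      intro v _
      refine (Finset.card_le_card (t := ball G 21 {v}) fun z hz => ?_).trans (hball v le_rfl).le
      exact mem_ball.2 ⟨v, by simp, (Finset.mem_filter.1 hz).2⟩) (by nlinarith)
  have hvnear : ∀ a b, a ≠ b → ∀ S T l l', (∀ u ∈ S, Near G l (v a) u) →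
      (∀ u ∈ T, Near G l' (v b) u) → l + 1 + l' ≤ 21 → ¬ Touch G S T :=
    fun a b hab S T l l' hS hT hl ht => (hv a b hab).2 ((Near.of_touch hS hT ht).mono hl)
  have hatt := fun a => exists_common_attachment (J := (Finset.univ : Finset D))
    (Y := Y (v a)) (Q := fun s T => Q s (c T (v a))) (hYcard _ (hAX (hvA a)))
    (K := Fintype.card (Sym2 W) + 1) (by
      rw [Finset.card_univ, Fintype.card_coe]
      exact hK.trans_le hD) (by
      intro T _
      obtain ⟨w, hw, y, hy, hwy⟩ := (hc T (v a) (hvA a)).2.2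
      obtain ⟨s, -, hw⟩ := Finset.mem_biUnion.1 hw
      exact ⟨y, hy, s, w, hw, hwy.imp Eq.symm fun h => h.symm⟩)
  choose y hyY s₁ J _ hJcard hJ using hatt
  have hs₀ : ∀ a, ∃ s, y a ∈ Q s (v a) := fun a => by
    obtain ⟨s, -, hs⟩ := Finset.mem_biUnion.1 (hyY a)
    exact ⟨s, hs⟩
  choose s₀ hs₀ using hs₀
  have j : ∀ a, Sym2 W ↪ J a := fun a =>
    (Function.Embedding.nonempty_of_card_le (by
      rw [Fintype.card_coe]
      exact (Nat.le_succ _).trans (hJcard a).le)).some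
  have hynear : ∀ a, ∀ u ∈ ({y a} : Finset V), Near G 3 (v a) u := fun a u hu => by
    rw [Finset.mem_singleton.1 hu]
    exact hYnear _ (hAX (hvA a)) _ (hyY a)
  have hQnear : ∀ a e s, ∀ u ∈ Q s (c (j a e) (v a)), Near G 10 (v a) u := fun a e s u hu =>
    hcnear _ _ (hvA a) u (hQY s _ hu)
  have hyc : ∀ a e s, y a ∉ Q s (c (j a e) (v a)) := by
    intro a e s hy
    -- There is always another leg attached at `y a`. If `y a` lay on one leg, the two would touch.
    obtain ⟨T, hT, hne⟩ := Finset.exists_mem_ne (lt_of_le_of_lt (by omega) (hJcard a))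
      (j a e : D)
    obtain ⟨w, hw, hyw⟩ := hJ a T hT
    exact hcc _ T hne.symm _ (hvA a) _ (hvA a) ⟨y a, hQY _ _ hy, w, hQY _ _ hw, hyw⟩
  refine exists_model_of_legs H hk hU hUU
    (fun s z hz => ⟨(hQ s z hz).1, (hQ s z hz).2.1, (hQ s z hz).2.2.1⟩) hQU
    (y := y) (s₀ := s₀) (s₁ := s₁) (c := fun a e => c (j a e) (v a))
    (fun a e => hcX _ _ (hvA a)) ?_ ?_ ?_ hyc ?_ ?_
  · exact fun a s hs ht => hQU (s₀ a) s hs.symm _ (hAX (hvA a))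
      (ht.mono (by simpa using hs₀ a) subset_rfl)
  · exact fun a b hab => hvnear a b hab _ _ 3 3 (hynear a) (hynear b) (by norm_num)
  · intro a e
    obtain ⟨w, hw, hyw⟩ := hJ a _ (j a e).2
    refine ⟨w, hw, (hyw.resolve_left ?_).symm⟩
    rintro h
    exact hyc a e _ (h ▸ hw)
  · exact fun a b e s hab => hvnear a b hab _ _ 3 10 (hynear a) (hQnear b e s) (by norm_num)
  · intro a b e e' s s' hne ht
    by_cases hab : a = b
    · subst hab
      exact hcc _ _ (fun h => hne ((j a).injective (Subtype.ext h))) _ (hvA a) _ (hvA a)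
        (ht.mono (hQY _ _) (hQY _ _))
    · exact hvnear a b hab _ _ 10 10 (hQnear a e s) (hQnear b e' s') (by norm_num) ht

end

/-! ### Combining the two cases; passing to small degrees -/

section
open scoped Classical

variable {V : Type*} {G : SimpleGraph V}

theorem card_filter_adj_induce_le [Fintype V] (X : Set V) [Fintype X] (x : X) :
    (Finset.univ.filter ((G.induce X).Adj x)).card ≤ (Finset.univ.filter (G.Adj x)).card := by
  refine Finset.card_le_card_of_injOn Subtype.val (fun y hy => ?_) Subtype.val_injective.injOn
  simpa using hy

theorem Coherent.induce [Fintype V] {m : ℕ} (h : Coherent G Finset.univ m) (X : Set V)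
    [Fintype X] : Coherent (G.induce X) Finset.univ m := fun A _ B _ hA hB =>
  touch_map (SimpleGraph.Embedding.induce X)
    (h _ (Finset.subset_univ _) _ (Finset.subset_univ _) (by rwa [Finset.card_map])
      (by rwa [Finset.card_map]))

/-- A coherent graph with many vertices and small degrees has a model of `H`. -/
theorem exists_model {W : Type*} [Fintype W] (H : SimpleGraph W) :
    ∃ C : ℕ, 1 ≤ C ∧ ∀ (V : Type*) [Fintype V] (G : SimpleGraph V) (m : ℕ), 1 ≤ m →
      C * m ≤ Fintype.card V → (∀ x, (Finset.univ.filter (G.Adj x)).card ≤ m) →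
      Coherent G Finset.univ m → ∃ h S, Model G H h S := by
  obtain ⟨t, ht⟩ : ∃ t, Fintype.card W = t := ⟨_, rfl⟩
  obtain ⟨E, hE⟩ : ∃ E, Fintype.card (Sym2 W) = E := ⟨_, rfl⟩
  obtain ⟨k, hk⟩ : ∃ k, k = E + 2 * t + 1 := ⟨_, rfl⟩
  obtain ⟨K, hK⟩ : ∃ K, K = k * 4 * k * (E + 1) + 1 := ⟨_, rfl⟩
  -- `C₁ * m` vertices suffice for the second case. `C₂` also covers the choice of hubs in the first
  -- case, where routes have at most 21 + 1 = 22 vertices.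
  obtain ⟨C₁, hC₁⟩ : ∃ C₁, C₁ = 2 ^ K * (3 ^ 2 ^ K * (t + 2)) + 3 * k := ⟨_, rfl⟩
  obtain ⟨C₂, hC₂⟩ : ∃ C₂, C₂ = C₁ + t * (2 * (E * 22 + 1) + 1) + 2 := ⟨_, rfl⟩
  refine ⟨2 ^ E * (3 ^ 2 ^ E * C₂), Nat.mul_pos (by positivity)
    (Nat.mul_pos (by positivity) (by omega)), ?_⟩
  intro V _ G m hm hV hdeg hcoh
  have h2 : 2 * m ≤ C₂ * m := Nat.mul_le_mul_right m (by omega)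
  by_cases hroot : ∀ X : Finset V, 3 * (C₂ * m) ≤ X.card →
      ∃ T ⊆ X, (∃ x, Rooted G 21 x T) ∧ m ≤ T.card
  · refine exists_model_of_rooted H hcoh hdeg h2 (by omega) hroot ?_ ?_
    · rw [ht, hE]
      have h3 : t * (2 * (E * 22 + 1) + 1) * m ≤ C₂ * m := Nat.mul_le_mul_right m (by omega)
      have h4 : t * 1 ≤ t * m := Nat.mul_le_mul_left t hm
      nlinarith
    · rw [hE]
      simpa only [mul_assoc] using hV
  · push Not at hroot
    obtain ⟨X, hX, hsmall⟩ := hroot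
    have hC : C₁ * m ≤ C₂ * m := Nat.mul_le_mul_right m (by omega)
    -- Distances and trees are now those of the subgraph induced on X; its trees of height at most
    -- 21 are trees of G inside X, hence small.
    obtain ⟨h, S, hmod⟩ := exists_model_of_not_rooted (G := G.induce (X : Set V)) H (k := k)
      (K := K) (hcoh.induce _) hm (fun x T hT => by
        have := hsmall (T.map (SimpleGraph.Embedding.induce (G := G) (X : Set V)).toEmbedding)
          (fun v hv => by
            obtain ⟨w, -, rfl⟩ := Finset.mem_map.1 hv
            exact w.2) ⟨_, hT.map (SimpleGraph.Embedding.induce (X : Set V))⟩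
        rwa [Finset.card_map] at this) (by omega) (by omega) (by rw [hE]; omega) (by
        refine le_of_le_of_eq ?_ (Fintype.card_coe X).symm
        rw [ht]
        have : C₁ * m = 2 ^ K * (3 ^ 2 ^ K * ((t + 2) * m)) + 3 * m * k := by
          rw [hC₁]
          ring
        omega)
    exact ⟨_, _, hmod.map (SimpleGraph.Embedding.induce (X : Set V))⟩

theorem sum_card_filter_adj [Fintype V] :
    ∑ x, (Finset.univ.filter (G.Adj x)).card = 2 * G.edgeSet.ncard := by
  rw [Set.ncard_eq_toFinset_card']
  refine Eq.trans (Finset.sum_congr rfl fun x _ => ?_) G.sum_degrees_eq_twice_card_edges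
  rw [← SimpleGraph.card_neighborFinset_eq_degree, SimpleGraph.neighborFinset_eq_filter]

/-- In a sparse graph at least half of the vertices have small degree. -/
theorem exists_half_small_degree [Fintype V] {m : ℕ} (hm : 1 ≤ m)
    (hE : 4 * G.edgeSet.ncard ≤ m * Fintype.card V) :
    ∃ X : Finset V, Fintype.card V ≤ 2 * X.card ∧
      ∀ x ∈ X, (Finset.univ.filter (G.Adj x)).card ≤ m := by
  refine ⟨Finset.univ.filter fun x => (Finset.univ.filter (G.Adj x)).card ≤ m, ?_,
    fun x hx => (Finset.mem_filter.1 hx).2⟩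
  have h1 := Finset.card_filter_add_card_filter_not (s := (Finset.univ : Finset V))
    (fun x => (Finset.univ.filter (G.Adj x)).card ≤ m)
  rw [Finset.card_univ] at h1
  have h2 : (Finset.univ.filter fun x => ¬ (Finset.univ.filter (G.Adj x)).card ≤ m).card * m ≤
      2 * G.edgeSet.ncard := by
    rw [← sum_card_filter_adj, ← smul_eq_mul]
    refine (Finset.card_nsmul_le_sum _ _ m fun x hx => ?_).trans
      (Finset.sum_le_sum_of_subset (Finset.filter_subset _ _))
    exact (not_le.1 (Finset.mem_filter.1 hx).2).le
  nlinarith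

end

end InducedSubdivision

/-! ### The theorem: choice of c and of the scale m -/

theorem mainTheorem4 {W : Type*} [Finite W] (H : SimpleGraph W) :
    ∃ c : ℝ, 0 < c ∧
      ∀ (V : Type*) [Fintype V] (G : SimpleGraph V),
        2 ≤ Fintype.card V →
        (G.edgeSet.ncard : ℝ) ≤ c * (Fintype.card V : ℝ) ^ 2 →
          G.ContainsInducedSubdivision H ∨
          ∃ A B : Finset V, G.Anticomplete A B ∧
            c * (Fintype.card V : ℝ) ≤ (A.card : ℝ) ∧
            c * (Fintype.card V : ℝ) ≤ (B.card : ℝ) := by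
  classical
  cases nonempty_fintype W
  obtain ⟨C, hC, hmodel⟩ := InducedSubdivision.exists_model H
  have hC' : (1 : ℝ) ≤ C := by exact_mod_cast hC
  refine ⟨1 / (16 * (C : ℝ) ^ 2), by positivity, ?_⟩
  intro V _ G hn hE
  obtain ⟨n, hnV⟩ : ∃ n, Fintype.card V = n := ⟨_, rfl⟩
  rw [hnV] at hn hE ⊢
  have hn' : (2 : ℝ) ≤ n := by exact_mod_cast hn
  rw [div_mul_eq_mul_div, one_mul, le_div_iff₀ (by positivity)] at hE
  -- Here c n² < 1, so G has no edges, and two single vertices suffice as c n ≤ 1.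
  by_cases hlarge : n < 4 * C
  · right
    have hlarge' : (n : ℝ) < 4 * C := by exact_mod_cast hlarge
    have hle : 1 / (16 * (C : ℝ) ^ 2) * n ≤ 1 := by
      rw [div_mul_eq_mul_div, one_mul, div_le_one (by positivity)]
      nlinarith
    have hzero : G.edgeSet.ncard = 0 := by
      by_contra hne
      have h1 : (1 : ℝ) ≤ G.edgeSet.ncard := by exact_mod_cast Nat.one_le_iff_ne_zero.2 hne
      nlinarith
    obtain ⟨a, b, hab⟩ := Fintype.exists_pair_of_one_lt_card (α := V) (by omega)
    refine ⟨{a}, {b}, ⟨by simpa using hab, ?_⟩, by simpa using hle, by simpa using hle⟩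
    intro x _ y _ hxy
    have hempty := (Set.ncard_eq_zero (Set.toFinite _)).1 hzero
    have hmem : s(x, y) ∈ G.edgeSet := hxy
    rw [hempty] at hmem
    exact hmem
  · rw [not_lt] at hlarge
    -- This makes n / 2, a lower bound for the number of vertices of small degree, at least C m.
    -- Rounding costs at most a factor 2, so n ≤ 4 C m, which gives both c n ≤ m and the edge bound.
    obtain ⟨m, hm⟩ : ∃ m, m = n / (2 * C) := ⟨_, rfl⟩
    have hm1 : 1 ≤ m := by
      rw [hm, Nat.one_le_div_iff (by omega)]
      omega
    have hmle : 2 * C * m ≤ n := hm ▸ Nat.mul_div_le n (2 * C)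
    have hmlt : n < 2 * C * (m + 1) := hm ▸ Nat.lt_mul_div_succ n (by omega)
    have hn4 : n ≤ 4 * C * m := by nlinarith
    have hn4' : (n : ℝ) ≤ 4 * C * m := by exact_mod_cast hn4
    have hm0 : (0 : ℝ) ≤ m := Nat.cast_nonneg m
    have hcn : 1 / (16 * (C : ℝ) ^ 2) * n ≤ m := by
      rw [div_mul_eq_mul_div, one_mul, div_le_iff₀ (by positivity)]
      nlinarith [mul_nonneg hm0 (mul_nonneg (by linarith : (0 : ℝ) ≤ C) (by linarith : (0 : ℝ) ≤ 4 * C - 1))]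
    have hedges : 4 * G.edgeSet.ncard ≤ m * Fintype.card V := by
      rw [hnV]
      have h1 : (G.edgeSet.ncard : ℝ) * (16 * (C : ℝ) ^ 2) ≤ (4 * C * m) * n := by nlinarith
      have h2 : (C : ℝ) * (4 * G.edgeSet.ncard * C) ≤ C * (m * n) := by nlinarith
      have h3 : 4 * (G.edgeSet.ncard : ℝ) * C ≤ m * n := le_of_mul_le_mul_left h2 (by linarith)
      have h4 : 4 * (G.edgeSet.ncard : ℝ) ≤ m * n :=
        (le_mul_of_one_le_right (by positivity) hC').trans h3
      exact_mod_cast h4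
    obtain ⟨X, hX, hdeg⟩ := InducedSubdivision.exists_half_small_degree hm1 hedges
    by_cases hcoh : InducedSubdivision.Coherent G Finset.univ m
    · left
      obtain ⟨h, S, hmod⟩ := hmodel (X : Set V) (G.induce (X : Set V)) m hm1
        (le_of_le_of_eq (by nlinarith) (Fintype.card_coe X).symm)
        (fun x => (InducedSubdivision.card_filter_adj_induce_le (G := G) (X : Set V) x).trans
          (hdeg x x.2))
        (hcoh.induce _)
      exact (hmod.map (SimpleGraph.Embedding.induce (X : Set V))).containsInducedSubdivision
    · right
      unfold InducedSubdivision.Coherent at hcoh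
      push Not at hcoh
      obtain ⟨A, -, B, -, hA, hB, hAB⟩ := hcoh
      refine ⟨A, B, ⟨Finset.disjoint_left.2 fun x hxA hxB => hAB ⟨x, hxA, x, hxB, Or.inl rfl⟩,
        fun a ha b hb hab => hAB ⟨a, ha, b, hb, Or.inr hab⟩⟩,
        hcn.trans (by exact_mod_cast hA), hcn.trans (by exact_mod_cast hB)⟩
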